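/- Let $\Delta$ be the Cantor set, let $C(\Delta)$ be the real Banach space of continuous functions on $\Delta$, and let $\mathrm{SB}$ be the set of all closed linear subspaces of $C(\Delta)$, with the Effros–Borel structure, i.e. the $\sigma$-algebra generated by the sets $\{X\in\mathrm{SB} : X\cap U\neq\emptyset\}$ with $U\subset C(\Delta)$ open. Write $X\hookrightarrow Y$ if $X$ is linearly homeomorphic to a subspace of $Y$, and $X\cong Y$ if $X$ and $Y$ are linearly homeomorphic. A set $A\subset\mathrm{SB}$ is $\Sigma^1_1$-hard if for every standard Borel space $S$ and every analytic set $B\subset S$ there is a Borel map $f\colon S\to\mathrm{SB}$ with $f^{-1}(A)=B$. Let $\mathcal P\subset\mathrm{SB}$ be a nonempty set of infinite-dimensional spaces which is closed under isomorphism (if $X\in\mathcal P$, $Y\in\mathrm{SB}$ and $Y\cong X$, then $Y\in\mathcal P$), and put $$C_{\mathcal P}=\{Y\in\mathrm{SB} : \text{there is } Z\in\mathcal P \text{ with } Z\hookrightarrow Y\}.$$ (1) Suppose that $\mathcal P$ is almost-pure: whenever $X\in\mathcal P$ and $Y\subset X$ is an infinite-dimensional closed subspace, there is an infinite-dimensional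 closed subspace $Z\subset Y$ with $Z\in\mathcal P$. If for some $p\in[1,\infty)$ the space $\ell_p$ embeds in no $Y\in\mathcal P$, or if $c_0$ embeds in no $Y\in\mathcal P$, then $C_{\mathcal P}$ is $\Sigma^1_1$-hard. (2) Suppose that $\mathcal P$ is pure: whenever $X\in\mathcal P$ and $Y\subset X$ is an infinite-dimensional closed subspace, $Y\in\mathcal P$. If for some $p\in[1,\infty)$ no member of $\mathcal P$ is isomorphic to $\ell_p$, or if no member of $\mathcal P$ is isomorphic to $c_0$, then $C_{\mathcal P}$ is $\Sigma^1_1$-hard. -/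

import Mathlib

open scoped ENNReal ZeroAtInfty

universe u v

/-- The Banach space `C(Δ)` of real continuous functions on the Cantor space `Δ = {0,1}^ℕ`, with
the supremum norm. -/
abbrev CDelta : Type := C(ℕ → Bool, ℝ)

/-- The coding `SB` of the separable Banach spaces: closed linear subspaces of `C(Δ)`. -/
abbrev SB : Type := ClosedSubmodule ℝ CDelta

/-- The Banach space coded by `X`. -/
abbrev SB.Space (X : SB) : Type := X.toSubmodule

/-- The Effros-Borel structure on `SB`, generated by the sets `{X | X ∩ U ≠ ∅}`, `U` open. -/
instance SB.effrosBorel : MeasurableSpace SB :=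
  MeasurableSpace.generateFrom
    {S : Set SB | ∃ U : Set CDelta, IsOpen U ∧ S = {X : SB | ((X : Set CDelta) ∩ U).Nonempty}}

/-- `X ↪ Y`: there is a linear isomorphism of `X` onto a subspace of `Y`, i.e. a bounded linear
map `X → Y` which is bounded below. -/
def Embeds (X : Type*) (Y : Type*) [NormedAddCommGroup X] [NormedSpace ℝ X]
    [NormedAddCommGroup Y] [NormedSpace ℝ Y] : Prop :=
  ∃ T : X →L[ℝ] Y, ∃ c : ℝ, 0 < c ∧ ∀ x : X, c * ‖x‖ ≤ ‖T x‖

/-- `X ≅ Y`: linear homeomorphism. -/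
def Isomorphic (X : Type*) (Y : Type*) [NormedAddCommGroup X] [NormedSpace ℝ X]
    [NormedAddCommGroup Y] [NormedSpace ℝ Y] : Prop :=
  Nonempty (X ≃L[ℝ] Y)

/-- The sequence space `ℓ_p`. -/
abbrev EllP (p : ℝ≥0∞) : Type := lp (fun _ : ℕ => ℝ) p

/-- The space `c_0` of real null sequences (functions on the discrete space `ℕ` vanishing at
infinity), with the supremum norm. -/
abbrev CZero : Type := C₀(ℕ, ℝ)

/-- `A` is analytic in a standard Borel space: it is analytic for a compatible Polish topology
(for one, or equivalently for every such topology). -/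
def IsSigmaOneOne {α : Type u} [MeasurableSpace α] (A : Set α) : Prop :=
  ∃ τ : TopologicalSpace α, @PolishSpace α τ ∧ @BorelSpace α τ _ ∧
    @MeasureTheory.AnalyticSet α τ A

/-- `A` is `Σ¹₁`-hard: every analytic subset of every standard Borel space is Borel reducible
to `A`. -/
def IsSigmaOneOneHard {α : Type u} [MeasurableSpace α] (A : Set α) : Prop :=
  ∀ (Y : Type v) [MeasurableSpace Y] [StandardBorelSpace Y] (B : Set Y), IsSigmaOneOne B →
    ∃ f : Y → α, Measurable f ∧ f ⁻¹' A = B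

namespace SB

/-- `X` is infinite dimensional. -/
def InfDim (X : SB) : Prop := ¬ FiniteDimensional ℝ X.Space

/-- A class of Banach spaces: a subset of `SB` closed under isomorphism. -/
def IsClass (P : Set SB) : Prop :=
  ∀ X Y : SB, X ∈ P → Isomorphic Y.Space X.Space → Y ∈ P

/-- Almost-pure class: every infinite dimensional closed subspace of a member contains an infinite
dimensional closed subspace which is a member. -/
def IsAlmostPure (P : Set SB) : Prop :=
  IsClass P ∧ ∀ X ∈ P, ∀ Y : SB, Y ≤ X → Y.InfDim → ∃ Z : SB, Z ≤ Y ∧ Z.InfDim ∧ Z ∈ P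

/-- Pure class: every infinite dimensional closed subspace of a member is a member. -/
def IsPure (P : Set SB) : Prop :=
  IsClass P ∧ ∀ X ∈ P, ∀ Y : SB, Y ≤ X → Y.InfDim → Y ∈ P

/-- `C_P`: the spaces into which some member of `P` embeds. -/
def containing (P : Set SB) : Set SB := {Y : SB | ∃ Z ∈ P, Embeds Z.Space Y.Space}

end SB

/-!
For a basic sequence `e` and an exponent `p`, the tree space of a tree `T` of finite sequences of
natural numbers is the completion of the finitely supported functions `x` on `T` under

  `‖x‖ = sup (∑ S, ‖∑ s ∈ S, x s • e s.length‖ ^ p) ^ (1 / p)`,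

where the supremum is over the families of pairwise incomparable segments `S` of `T` (for `p = ∞`
the sum over `S` is a supremum). All these spaces live in one `ℓ_∞`-sum of `ℓ_p`-sums, `TreeSpace`.

* If `T` has an infinite branch, the basis vectors along it are equivalent to `e`, so the closed
  span of `e` embeds into the tree space (`equivalentSequences_branch`).
* If `T` has no infinite branch, every infinite dimensional subspace `Y` of the tree space contains
  a copy of `ℓ_p`, or of `c_0` if `p = ∞` (`exists_equivalentSequences_lpUnit`). There is a last
  node `t` such that the restriction to the nodes above `t` is bounded below on an infinite
  dimensional subspace of `Y`. The restrictions to the nodes above the single children of `t` are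
  then strictly singular on that subspace, and a gliding hump yields unit vectors that are almost
  supported above disjoint sets of children. On such vectors the norm is an `ℓ_p`-norm, since
  segments above different children are incomparable
  (`norm_linearCombination_blocks`).

An analytic set `B` consists of the points `s` at which a Borel family of trees `T s` has an
infinite branch (`IsSigmaOneOne.exists_trees`). By Banach–Mazur, the tree space of the full tree
embeds isometrically into `C(Δ)`, and `s ↦` the tree space of `T s` is a Borel map into `SB`
(`measurable_closure_span`). If `e` is taken in a member of an almost-pure class, then this map
reduces `B` to `SB.containing P` provided that no member contains `ℓ_p` (or `c_0`). For a pure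
class, a member containing `ℓ_p` would have a subspace isomorphic to `ℓ_p` in the class.
-/

/-! ### Equivalent sequences and the unit vectors of `ℓ_p` and `c_0` -/

/-- The sequences `g` and `y` are equivalent: the finite linear combinations of `g` and of `y` with
the same coefficients have norms that agree up to constants. -/
def EquivalentSequences {G Z : Type*} [NormedAddCommGroup G] [NormedSpace ℝ G]
    [NormedAddCommGroup Z] [NormedSpace ℝ Z] (g : ℕ → G) (y : ℕ → Z) : Prop :=
  ∃ c C : ℝ, 0 < c ∧ ∀ a : ℕ →₀ ℝ,
    c * ‖Finsupp.linearCombination ℝ g a‖ ≤ ‖Finsupp.linearCombination ℝ y a‖ ∧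
    ‖Finsupp.linearCombination ℝ y a‖ ≤ C * ‖Finsupp.linearCombination ℝ g a‖

/-- An equivalence of `g` and `y` extends to an embedding of the closed span of `g`. -/
theorem EquivalentSequences.embeds {G Z : Type*} [NormedAddCommGroup G] [NormedSpace ℝ G]
    [NormedAddCommGroup Z] [NormedSpace ℝ Z] [CompleteSpace Z] {g : ℕ → G} {y : ℕ → Z}
    (h : EquivalentSequences g y) (hg : Dense (Submodule.span ℝ (Set.range g) : Set G)) :
    Embeds G Z := by
  obtain ⟨c, C, hc, h⟩ := h
  have hd : DenseRange (Finsupp.linearCombination ℝ g) := by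
    rw [← Finsupp.range_linearCombination] at hg
    exact hg
  have hC : ∃ C : ℝ, ∀ a, ‖Finsupp.linearCombination ℝ y a‖ ≤
      C * ‖Finsupp.linearCombination ℝ g a‖ := ⟨C, fun a => (h a).2⟩
  refine ⟨(Finsupp.linearCombination ℝ y).extendOfNorm (Finsupp.linearCombination ℝ g), c, hc, ?_⟩
  intro x
  refine hd.induction_on (p := fun x => c * ‖x‖ ≤ ‖((Finsupp.linearCombination ℝ y).extendOfNorm
    (Finsupp.linearCombination ℝ g)) x‖) x (isClosed_le (by fun_prop) (by fun_prop)) ?_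
  intro a
  rw [LinearMap.extendOfNorm_eq hd hC]
  exact (h a).1

/-- Equivalence of sequences can be tested after applying an operator that is bounded below. -/
theorem EquivalentSequences.of_map {G Z W : Type*} [NormedAddCommGroup G] [NormedSpace ℝ G]
    [NormedAddCommGroup Z] [NormedSpace ℝ Z] [NormedAddCommGroup W] [NormedSpace ℝ W]
    {g : ℕ → G} {z : ℕ → Z} (U : Z →L[ℝ] W) {c : ℝ} (hc : 0 < c) (hU : ∀ z, c * ‖z‖ ≤ ‖U z‖)
    (h : EquivalentSequences g fun k => U (z k)) : EquivalentSequences g z := by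
  obtain ⟨c', C, hc', h⟩ := h
  have key : ∀ a : ℕ →₀ ℝ, Finsupp.linearCombination ℝ (fun k => U (z k)) a =
      U (Finsupp.linearCombination ℝ z a) := by
    intro a
    simp [Finsupp.linearCombination_apply, Finsupp.sum]
  refine ⟨c' / (‖U‖ + 1), C / c, by positivity, fun a => ?_⟩
  obtain ⟨h1, h2⟩ := h a
  rw [key] at h1 h2
  constructor
  · rw [div_mul_eq_mul_div, div_le_iff₀ (by positivity)]
    have := U.le_opNorm (Finsupp.linearCombination ℝ z a)
    nlinarith [norm_nonneg (Finsupp.linearCombination ℝ z a)]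
  · rw [div_mul_eq_mul_div, le_div_iff₀ hc]
    nlinarith [hU (Finsupp.linearCombination ℝ z a)]

theorem EquivalentSequences.congr_norm {G G' Z : Type*} [NormedAddCommGroup G] [NormedSpace ℝ G]
    [NormedAddCommGroup G'] [NormedSpace ℝ G'] [NormedAddCommGroup Z] [NormedSpace ℝ Z]
    {g : ℕ → G} {g' : ℕ → G'} {z : ℕ → Z}
    (hg : ∀ a : ℕ →₀ ℝ, ‖Finsupp.linearCombination ℝ g a‖ = ‖Finsupp.linearCombination ℝ g' a‖)
    (h : EquivalentSequences g z) : EquivalentSequences g' z := by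
  obtain ⟨c, C, hc, h⟩ := h
  exact ⟨c, C, hc, fun a => by simpa only [hg] using h a⟩

section SequenceSpaces

variable {p : ℝ≥0∞}

/-- The unit vector basis of `ℓ_p`. -/
noncomputable def lpUnit (p : ℝ≥0∞) (k : ℕ) : EllP p := lp.single p k 1

theorem lp_linearCombination_apply {L V : Type*} [NormedAddCommGroup V] [NormedSpace ℝ V]
    (v : ℕ → lp (fun _ : L => V) p) (a : ℕ →₀ ℝ) (j : L) :
    Finsupp.linearCombination ℝ v a j = ∑ k ∈ a.support, a k • v k j := by
  rw [Finsupp.linearCombination_apply, Finsupp.sum, lp.coeFn_sum, Finset.sum_apply]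
  rfl

theorem lpUnit_linearCombination_apply (a : ℕ →₀ ℝ) (j : ℕ) :
    Finsupp.linearCombination ℝ (lpUnit p) a j = a j := by
  rw [lp_linearCombination_apply]
  simp only [lpUnit, lp.single_apply, Pi.single_apply]
  simp [eq_comm]

theorem dense_span_lpUnit [hp1 : Fact (1 ≤ p)] (hp : p ≠ ⊤) :
    Dense (Submodule.span ℝ (Set.range (lpUnit p)) : Set (EllP p)) := by
  intro f
  refine mem_closure_of_tendsto (lp.hasSum_single hp f) (Filter.Eventually.of_forall fun s => ?_)
  refine Submodule.sum_mem _ fun i _ => ?_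
  have : lp.single p i (f i) = f i • lpUnit p i := by
    rw [lpUnit, ← lp.single_smul]; simp
  rw [this]
  exact Submodule.smul_mem _ _ (Submodule.subset_span ⟨i, rfl⟩)

/-- The unit vector basis of `c_0`. -/
noncomputable def czeroUnit (k : ℕ) : CZero where
  toFun := Pi.single k 1
  continuous_toFun := continuous_of_discreteTopology
  zero_at_infty' := by
    refine tendsto_const_nhds.congr' ?_
    rw [Filter.cocompact_eq_cofinite]
    filter_upwards [(Set.finite_singleton k).compl_mem_cofinite] with j hj
    simp at hj
    simp [hj]

theorem czeroUnit_linearCombination_apply (a : ℕ →₀ ℝ) (j : ℕ) :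
    Finsupp.linearCombination ℝ czeroUnit a j = a j := by
  have h : ∀ k, czeroUnit k j = Pi.single (M := fun _ => ℝ) k 1 j := fun k => rfl
  have h2 : Finsupp.linearCombination ℝ czeroUnit a j = ∑ k ∈ a.support, a k * czeroUnit k j := by
    rw [Finsupp.linearCombination_apply, Finsupp.sum]
    induction a.support using Finset.induction_on with
    | empty => simp
    | insert k s hk ih => rw [Finset.sum_insert hk, Finset.sum_insert hk, ← ih]; simp
  rw [h2]
  simp only [h, Pi.single_apply]
  simp [eq_comm]

theorem czero_norm_le {f : CZero} {C : ℝ} (hC : 0 ≤ C) (h : ∀ j, |f j| ≤ C) : ‖f‖ ≤ C := by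
  rw [← ZeroAtInftyContinuousMap.norm_toBCF_eq_norm, BoundedContinuousFunction.norm_le hC]
  exact h

theorem czero_abs_apply_le (f : CZero) (j : ℕ) : |f j| ≤ ‖f‖ := by
  rw [← ZeroAtInftyContinuousMap.norm_toBCF_eq_norm]
  exact f.toBCF.norm_coe_le_norm j

theorem norm_linearCombination_lpUnit_top (a : ℕ →₀ ℝ) :
    ‖Finsupp.linearCombination ℝ (lpUnit ⊤) a‖ = ‖Finsupp.linearCombination ℝ czeroUnit a‖ := by
  apply le_antisymm
  · refine lp.norm_le_of_forall_le (norm_nonneg _) fun j => ?_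
    rw [lpUnit_linearCombination_apply, ← czeroUnit_linearCombination_apply]
    exact czero_abs_apply_le _ j
  · refine czero_norm_le (norm_nonneg _) fun j => ?_
    rw [czeroUnit_linearCombination_apply, ← lpUnit_linearCombination_apply (p := ⊤)]
    exact lp.norm_apply_le_norm ENNReal.top_ne_zero (Finsupp.linearCombination ℝ (lpUnit ⊤) a) j

theorem dense_span_czeroUnit :
    Dense (Submodule.span ℝ (Set.range czeroUnit) : Set CZero) := by
  intro f
  rw [Metric.mem_closure_iff]
  intro ε hε
  have hfin : {j | ¬ |f j| < ε / 2}.Finite := by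
    have h := f.zero_at_infty'
    rw [Filter.cocompact_eq_cofinite] at h
    have h2 := h.eventually (Metric.ball_mem_nhds (0 : ℝ) (half_pos hε))
    simpa [Filter.eventually_cofinite, Real.dist_eq] using h2
  set a : ℕ →₀ ℝ := Finsupp.onFinset hfin.toFinset
    (fun j => if j ∈ hfin.toFinset then f j else 0) (by intro j; aesop) with ha
  refine ⟨Finsupp.linearCombination ℝ czeroUnit a, ?_, ?_⟩
  · rw [← Finsupp.range_linearCombination]
    exact ⟨a, rfl⟩
  · rw [dist_eq_norm]
    refine lt_of_le_of_lt (czero_norm_le (half_pos hε).le fun j => ?_) (half_lt_self hε)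
    rw [ZeroAtInftyContinuousMap.sub_apply, czeroUnit_linearCombination_apply, ha,
      Finsupp.onFinset_apply]
    by_cases hj : |f j| < ε / 2
    · rw [if_neg (by simpa using hj), sub_zero]
      exact hj.le
    · rw [if_pos (by simpa using hj), sub_self, abs_zero]
      exact (half_pos hε).le

theorem lp_norm_le_of_injective [hp1 : Fact (1 ≤ p)] {L V : Type*} [NormedAddCommGroup V]
    {φ : L → L} (hφ : Function.Injective φ)
    {f g : lp (fun _ : L => V) p} (h : ∀ j, g (φ j) = f j) : ‖f‖ ≤ ‖g‖ := by
  have h0 : 0 < p := zero_lt_one.trans_le hp1.out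
  by_cases hp : p = ⊤
  · subst hp
    refine lp.norm_le_of_forall_le (norm_nonneg _) fun j => ?_
    rw [← h]
    exact lp.norm_apply_le_norm (by simp) g _
  · have hp' : 0 < p.toReal := ENNReal.toReal_pos h0.ne' hp
    refine lp.norm_le_of_forall_sum_le hp' (norm_nonneg _) fun s => ?_
    refine le_trans (le_of_eq ?_) (lp.sum_rpow_le_norm_rpow hp' g (s.map ⟨φ, hφ⟩))
    simp [h]

variable {L V : Type*} [NormedAddCommGroup V] [NormedSpace ℝ V]

theorem norm_linearCombination_rpow_of_disjoint (hp : 0 < p.toReal)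
    {v : ℕ → lp (fun _ : L => V) p} (hv : ∀ j k l, v k j ≠ 0 → v l j ≠ 0 → k = l) (a : ℕ →₀ ℝ) :
    ‖Finsupp.linearCombination ℝ v a‖ ^ p.toReal =
      ∑ k ∈ a.support, |a k| ^ p.toReal * ‖v k‖ ^ p.toReal := by
  have key : ∀ j, ‖Finsupp.linearCombination ℝ v a j‖ ^ p.toReal =
      ∑ k ∈ a.support, |a k| ^ p.toReal * ‖v k j‖ ^ p.toReal := by
    intro j
    rw [lp_linearCombination_apply]
    by_cases h : ∃ k, v k j ≠ 0
    · obtain ⟨k, hk⟩ := h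
      have h0 : ∀ l, l ≠ k → v l j = 0 := fun l hl => by
        by_contra h; exact hl (hv j l k h hk)
      rw [Finset.sum_eq_single k (fun l _ hl => by simp [h0 l hl]) (by simp +contextual),
        Finset.sum_eq_single k (fun l _ hl => by simp [h0 l hl, Real.zero_rpow hp.ne'])
          (by simp +contextual [Real.zero_rpow hp.ne']), norm_smul, Real.norm_eq_abs,
        Real.mul_rpow (abs_nonneg _) (norm_nonneg _)]
    · push Not at h
      simp [h, Real.zero_rpow hp.ne']
  rw [lp.norm_rpow_eq_tsum hp]
  simp_rw [key]
  rw [Summable.tsum_finsetSum fun k _ => ((lp.memℓp (v k)).summable hp).mul_left _]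
  refine Finset.sum_congr rfl fun k _ => ?_
  rw [tsum_mul_left, lp.norm_rpow_eq_tsum hp]

theorem norm_linearCombination_lpUnit_rpow [hp1 : Fact (1 ≤ p)] (hp : 0 < p.toReal) (a : ℕ →₀ ℝ) :
    ‖Finsupp.linearCombination ℝ (lpUnit p) a‖ ^ p.toReal =
      ∑ k ∈ a.support, |a k| ^ p.toReal := by
  rw [norm_linearCombination_rpow_of_disjoint hp]
  · have h0 : 0 < p := zero_lt_one.trans_le hp1.out
    refine Finset.sum_congr rfl fun k _ => ?_
    rw [lpUnit, lp.norm_single h0]; simp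
  · intro j k l hk hl
    have h : ∀ k, lpUnit p k j ≠ 0 → k = j := by
      intro k hk
      by_contra h
      exact hk (lp.single_apply_ne p k _ (fun h' => h h'.symm))
    exact (h k hk).trans (h l hl).symm

theorem norm_linearCombination_le_of_disjoint [hp1 : Fact (1 ≤ p)]
    {v : ℕ → lp (fun _ : L => V) p}
    (hv : ∀ j k l, v k j ≠ 0 → v l j ≠ 0 → k = l) {C : ℝ} (hC : 0 ≤ C) (hvC : ∀ k, ‖v k‖ ≤ C)
    (a : ℕ →₀ ℝ) :
    ‖Finsupp.linearCombination ℝ v a‖ ≤ C * ‖Finsupp.linearCombination ℝ (lpUnit p) a‖ := by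
  have h0 : 0 < p := zero_lt_one.trans_le hp1.out
  by_cases hp : p = ⊤
  · subst hp
    refine lp.norm_le_of_forall_le (by positivity) fun j => ?_
    rw [lp_linearCombination_apply]
    by_cases h : ∃ k, v k j ≠ 0
    · obtain ⟨k, hk⟩ := h
      have h0 : ∀ l, l ≠ k → v l j = 0 := fun l hl => by
        by_contra h; exact hl (hv j l k h hk)
      rw [Finset.sum_eq_single k (fun l _ hl => by simp [h0 l hl]) (by simp +contextual),
        norm_smul, mul_comm]
      have h1 := lp.norm_apply_le_norm (by simp) (Finsupp.linearCombination ℝ (lpUnit ⊤) a) k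
      rw [lpUnit_linearCombination_apply] at h1
      exact mul_le_mul ((lp.norm_apply_le_norm (by simp) _ _).trans (hvC k)) h1 (norm_nonneg _) hC
    · push Not at h
      simp only [h, smul_zero, Finset.sum_const_zero, norm_zero]
      positivity
  · have hp' : 0 < p.toReal := ENNReal.toReal_pos h0.ne' hp
    rw [← Real.rpow_le_rpow_iff (norm_nonneg _) (by positivity) hp',
      Real.mul_rpow hC (norm_nonneg _), norm_linearCombination_rpow_of_disjoint hp' hv,
      norm_linearCombination_lpUnit_rpow hp', Finset.mul_sum]
    refine Finset.sum_le_sum fun k _ => ?_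
    rw [mul_comm]
    have := hvC k
    gcongr

theorem le_norm_linearCombination_of_disjoint [hp1 : Fact (1 ≤ p)]
    {v : ℕ → lp (fun _ : L => V) p}
    (hv : ∀ j k l, v k j ≠ 0 → v l j ≠ 0 → k = l) {c : ℝ} (hc : 0 ≤ c) (hvc : ∀ k, c ≤ ‖v k‖)
    (a : ℕ →₀ ℝ) :
    c * ‖Finsupp.linearCombination ℝ (lpUnit p) a‖ ≤ ‖Finsupp.linearCombination ℝ v a‖ := by
  have h0 : 0 < p := zero_lt_one.trans_le hp1.out
  by_cases hp : p = ⊤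
  · subst hp
    rcases hc.eq_or_lt with rfl | hc
    · simp
    rw [mul_comm, ← le_div_iff₀ hc]
    refine lp.norm_le_of_forall_le (by positivity) fun k => ?_
    rw [lpUnit_linearCombination_apply, le_div_iff₀ hc]
    refine (mul_le_mul_of_nonneg_left (hvc k) (norm_nonneg _)).trans ?_
    rw [← norm_smul]
    refine lp.norm_le_of_forall_le (norm_nonneg _) fun j => ?_
    by_cases hk : v k j = 0
    · simp [hk]
    have h0 : ∀ l, l ≠ k → v l j = 0 := fun l hl => by
      by_contra h; exact hl (hv j l k h hk)
    have h1 := lp.norm_apply_le_norm (by simp) (Finsupp.linearCombination ℝ v a) j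
    rw [lp_linearCombination_apply, Finset.sum_eq_single k (fun l _ hl => by simp [h0 l hl])
      (by simp +contextual)] at h1
    simpa using h1
  · have hp' : 0 < p.toReal := ENNReal.toReal_pos h0.ne' hp
    rw [← Real.rpow_le_rpow_iff (by positivity) (norm_nonneg _) hp',
      Real.mul_rpow hc (norm_nonneg _), norm_linearCombination_rpow_of_disjoint hp' hv,
      norm_linearCombination_lpUnit_rpow hp', Finset.mul_sum]
    refine Finset.sum_le_sum fun k _ => ?_
    rw [mul_comm]
    have := hvc k
    gcongr

theorem abs_apply_le_norm_linearCombination_lpUnit [hp1 : Fact (1 ≤ p)] (a : ℕ →₀ ℝ)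
    (k : ℕ) :
    |a k| ≤ ‖Finsupp.linearCombination ℝ (lpUnit p) a‖ := by
  have h0 : 0 < p := zero_lt_one.trans_le hp1.out
  have := lp.norm_apply_le_norm h0.ne' (Finsupp.linearCombination ℝ (lpUnit p) a) k
  rwa [lpUnit_linearCombination_apply] at this

end SequenceSpaces

/-! ### Infinite dimensional subspaces and basic sequences -/

section InfiniteDimensional

variable {E F : Type*} [NormedAddCommGroup E] [NormedSpace ℝ E] [NormedAddCommGroup F]
  [NormedSpace ℝ F]

theorem Submodule.not_fg_of_linearIndependent {Y : Submodule ℝ E} {y : ℕ → E}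
    (hy : LinearIndependent ℝ y) (hyY : ∀ n, y n ∈ Y) : ¬ Y.FG := by
  intro h
  have : Module.Finite ℝ Y := Module.Finite.iff_fg.2 h
  have hli : LinearIndependent ℝ (fun n => (⟨y n, hyY n⟩ : Y)) :=
    LinearIndependent.of_comp Y.subtype hy
  have := hli.finite_of_isNoetherian
  exact not_finite ℕ

theorem Submodule.not_fg_inf_ker {Y : Submodule ℝ E} (hY : ¬ Y.FG) (s : Finset (E →L[ℝ] ℝ)) :
    ∃ Y' ≤ Y, ¬ Y'.FG ∧ ∀ f ∈ s, ∀ y ∈ Y', f y = 0 := by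
  classical
  induction s using Finset.induction_on with
  | empty => exact ⟨Y, le_rfl, hY, by simp⟩
  | insert f s _ ih =>
    obtain ⟨Y', hle, hfg, h⟩ := ih
    refine ⟨Y' ⊓ LinearMap.ker (f : E →ₗ[ℝ] ℝ), inf_le_left.trans hle, fun h' => hfg ?_, ?_⟩
    · exact Submodule.fg_of_fg_map_of_fg_inf_ker (f : E →ₗ[ℝ] ℝ) (IsNoetherian.noetherian _) h'
    · intro g hg y hy
      rcases Finset.mem_insert.1 hg with rfl | hg
      · exact hy.2
      · exact h g hg y hy.1

theorem Submodule.exists_norm_eq_one {Y : Submodule ℝ E} (hY : ¬ Y.FG) : ∃ y ∈ Y, ‖y‖ = 1 := by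
  have : Y ≠ ⊥ := by rintro rfl; exact hY Submodule.fg_bot
  obtain ⟨y, hy, h0⟩ := Submodule.exists_mem_ne_zero_of_ne_bot this
  refine ⟨‖y‖⁻¹ • y, Y.smul_mem _ hy, ?_⟩
  rw [norm_smul, norm_inv, norm_norm, inv_mul_cancel₀ (norm_ne_zero_iff.2 h0)]

/-- `S` is strictly singular on `Y`: it is not bounded below on any infinite dimensional subspace
of `Y`. Here and below, `¬ Y.FG` says that `Y` is infinite dimensional. -/
def StrictlySingularOn (S : E →L[ℝ] F) (Y : Submodule ℝ E) : Prop :=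
  ∀ Y' ≤ Y, ¬ Y'.FG → ∀ c > 0, ∃ y ∈ Y', ‖S y‖ < c * ‖y‖

theorem StrictlySingularOn.mono {S : E →L[ℝ] F} {Y Y' : Submodule ℝ E}
    (h : StrictlySingularOn S Y) (hle : Y' ≤ Y) : StrictlySingularOn S Y' :=
  fun Z hZ => h Z (hZ.trans hle)

/-- If the functionals `f` are triangular on the unit vectors `y`, then the `n`-th coefficient is
determined by `f n` and the preceding coefficients, and its bound doubles with every step. -/
theorem abs_coeff_le_of_triangular {y : ℕ → E} {f : ℕ → E →L[ℝ] ℝ} (hy : ∀ n, ‖y n‖ = 1)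
    (hf : ∀ n, ‖f n‖ ≤ 1) (hfy : ∀ n, f n (y n) = 1) (h0 : ∀ m n, m < n → f m (y n) = 0)
    (a : ℕ →₀ ℝ) (n : ℕ) : |a n| ≤ 2 ^ n * ‖Finsupp.linearCombination ℝ y a‖ := by
  induction n using Nat.strong_induction_on with
  | _ n ih =>
    set x := Finsupp.linearCombination ℝ y a with hx
    obtain ⟨M, hM⟩ : ∃ M, n < M ∧ a.support ⊆ Finset.range M := by
      refine ⟨a.support.sup id + n + 1, by omega, fun k hk => ?_⟩
      have := Finset.le_sup (f := id) hk
      simp only [id, Finset.mem_range] at *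
      omega
    have h1 : f n x = ∑ k ∈ Finset.range M, a k * f n (y k) := by
      rw [hx, Finsupp.linearCombination_apply, Finsupp.sum_of_support_subset a hM.2 _ (by simp)]
      simp
    have h2 : ∑ k ∈ Finset.range M, a k * f n (y k) =
        ∑ k ∈ Finset.range n, a k * f n (y k) + a n := by
      rw [← Finset.sum_subset (Finset.range_subset_range.2 (Nat.succ_le_of_lt hM.1)),
        Finset.sum_range_succ, hfy, mul_one]
      intro k _ hk
      rw [h0 n k (by simpa using hk), mul_zero]
    have h3 : |f n x| ≤ ‖x‖ := by
      have := (f n).le_opNorm x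
      have := mul_le_mul_of_nonneg_right (hf n) (norm_nonneg x)
      rw [Real.norm_eq_abs] at *
      linarith
    have h4 : |∑ k ∈ Finset.range n, a k * f n (y k)| ≤ ∑ k ∈ Finset.range n, 2 ^ k * ‖x‖ := by
      refine (Finset.abs_sum_le_sum_abs _ _).trans (Finset.sum_le_sum fun k hk => ?_)
      rw [abs_mul]
      have h5 : |f n (y k)| ≤ 1 := by
        have := (f n).le_opNorm (y k)
        rw [hy k, mul_one] at this
        exact this.trans (hf n)
      calc |a k| * |f n (y k)| ≤ |a k| * 1 := by gcongr
        _ ≤ _ := by rw [mul_one]; exact ih k (Finset.mem_range.1 hk)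
    rw [← Finset.sum_mul, geom_sum_eq (by norm_num)] at h4
    have h6 : a n = f n x - ∑ k ∈ Finset.range n, a k * f n (y k) := by rw [h1, h2]; ring
    rw [h6]
    refine (abs_sub _ _).trans ?_
    norm_num at h4
    linarith

/-- A strictly singular operator has arbitrarily small restrictions to infinite dimensional
subspaces. The subspace is spanned by unit vectors `y n` with rapidly decreasing `‖S (y n)‖`, on
which norm-one functionals are triangular, so that coefficients grow at most like `2 ^ n`. -/
theorem StrictlySingularOn.exists_norm_le {S : E →L[ℝ] F} {Y : Submodule ℝ E} (hY : ¬ Y.FG)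
    (hS : StrictlySingularOn S Y) {ε : ℝ} (hε : 0 < ε) :
    ∃ Y' ≤ Y, ¬ Y'.FG ∧ ∀ y ∈ Y', ‖S y‖ ≤ ε * ‖y‖ := by
  classical
  -- the first component is an index, at least `n` at the `n`-th step, that controls `‖S y‖`
  obtain ⟨u, hu, hr⟩ := exists_seq_of_forall_finset_exists
    (fun x : ℕ × E × (E →L[ℝ] ℝ) => x.2.1 ∈ Y ∧ ‖x.2.1‖ = 1 ∧ ‖x.2.2‖ ≤ 1 ∧
      x.2.2 x.2.1 = 1 ∧ ‖S x.2.1‖ ≤ ε / 2 * (1 / 4) ^ x.1)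
    (fun x z => x.1 < z.1 ∧ x.2.2 z.2.1 = 0) (by
      intro s _
      obtain ⟨Y', hle, hfg, h⟩ := Submodule.not_fg_inf_ker hY (s.image fun x => x.2.2)
      have hpos : 0 < ε / 2 * (1 / 4 : ℝ) ^ (s.sup (fun x => x.1) + 1) := by positivity
      obtain ⟨y, hy, hlt⟩ := hS Y' hle hfg _ hpos
      have hy0 : y ≠ 0 := by rintro rfl; simp at hlt
      have hn : 0 < ‖y‖ := norm_pos_iff.2 hy0
      have hone : ‖‖y‖⁻¹ • y‖ = 1 := by
        rw [norm_smul, norm_inv, norm_norm, inv_mul_cancel₀ hn.ne']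
      obtain ⟨f, hf, hfy⟩ := exists_dual_vector ℝ (‖y‖⁻¹ • y)
        (by rw [← norm_ne_zero_iff]; simp [hone])
      refine ⟨(s.sup (fun x => x.1) + 1, ‖y‖⁻¹ • y, f),
        ⟨Y.smul_mem _ (hle hy), hone, hf.le, ?_, ?_⟩, fun x hx => ⟨?_, ?_⟩⟩
      · rw [hfy, hone]; simp
      · simp only [map_smul, norm_smul, norm_inv, norm_norm]
        rw [inv_mul_le_iff₀ hn, mul_comm]
        exact hlt.le
      · exact Nat.lt_succ_of_le (Finset.le_sup (f := fun x => x.1) hx)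
      · exact h _ (Finset.mem_image_of_mem _ hx) _ (Y'.smul_mem _ hy))
  have hidx : StrictMono fun n => (u n).1 := fun m n hmn => (hr m n hmn).1
  have hco := abs_coeff_le_of_triangular (y := fun n => (u n).2.1) (f := fun n => (u n).2.2)
    (fun n => (hu n).2.1) (fun n => (hu n).2.2.1) (fun n => (hu n).2.2.2.1)
    (fun m n hmn => (hr m n hmn).2)
  refine ⟨Submodule.span ℝ (Set.range fun n => (u n).2.1), ?_, ?_, ?_⟩
  · rw [Submodule.span_le]
    rintro _ ⟨n, rfl⟩
    exact (hu n).1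
  · refine Submodule.not_fg_of_linearIndependent ?_ fun n => Submodule.subset_span ⟨n, rfl⟩
    rw [linearIndependent_iff]
    intro a ha
    ext n
    have := hco a n
    rw [ha, norm_zero, mul_zero] at this
    exact abs_nonpos_iff.1 this
  · intro y hy
    rw [← Finsupp.range_linearCombination] at hy
    obtain ⟨a, rfl⟩ := hy
    set x := Finsupp.linearCombination ℝ (fun n => (u n).2.1) a with hx
    calc ‖S x‖ = ‖∑ n ∈ a.support, a n • S (u n).2.1‖ := by
          rw [hx, Finsupp.linearCombination_apply, Finsupp.sum]; simp
      _ ≤ ∑ n ∈ a.support, ‖a n • S (u n).2.1‖ := norm_sum_le _ _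
      _ ≤ ∑ n ∈ a.support, ε / 2 * ‖x‖ * (1 / 2) ^ n := by
          refine Finset.sum_le_sum fun n _ => ?_
          rw [norm_smul, Real.norm_eq_abs]
          have h1 : ‖S (u n).2.1‖ ≤ ε / 2 * (1 / 4) ^ n :=
            (hu n).2.2.2.2.trans (mul_le_mul_of_nonneg_left
              (pow_le_pow_of_le_one (by norm_num) (by norm_num) (hidx.le_apply (x := n)))
              (half_pos hε).le)
          refine (mul_le_mul (hco a n) h1 (norm_nonneg _) (by positivity)).trans (le_of_eq ?_)
          have h2 : (1 / 2 : ℝ) ^ n = 2 ^ n * (1 / 4) ^ n := by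
            rw [← mul_pow]; norm_num
          rw [h2]; ring
      _ ≤ ε / 2 * ‖x‖ * 2 := by
          rw [← Finset.mul_sum]
          refine mul_le_mul_of_nonneg_left ?_ (by positivity)
          exact (summable_geometric_two.sum_le_tsum _ fun _ _ => by positivity).trans
            tsum_geometric_two.le
      _ = ε * ‖x‖ := by ring

theorem exists_norm_le_of_strictlySingularOn_finset {ι : Type*} (s : Finset ι) (S : ι → E →L[ℝ] F)
    {Y : Submodule ℝ E} (hY : ¬ Y.FG) (hS : ∀ i ∈ s, StrictlySingularOn (S i) Y)
    {ε : ℝ} (hε : 0 < ε) :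
    ∃ Y' ≤ Y, ¬ Y'.FG ∧ ∀ i ∈ s, ∀ y ∈ Y', ‖S i y‖ ≤ ε * ‖y‖ := by
  classical
  induction s using Finset.induction_on with
  | empty => exact ⟨Y, le_rfl, hY, by simp⟩
  | insert i s _ ih =>
    obtain ⟨Y', hle, hfg, h⟩ := ih fun j hj => hS j (Finset.mem_insert_of_mem hj)
    obtain ⟨Z, hZ, hZfg, hZS⟩ :=
      ((hS i (Finset.mem_insert_self i s)).mono hle).exists_norm_le hfg hε
    refine ⟨Z, hZ.trans hle, hZfg, fun j hj y hy => ?_⟩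
    rcases Finset.mem_insert.1 hj with rfl | hj
    · exact hZS y hy
    · exact h j hj y (hZ hy)

/-- Mazur's step: for a finite dimensional `G`, all `w` in the kernel of suitable finitely many
functionals are almost orthogonal to `G`. -/
theorem exists_finset_dual_almost_norming {G : Submodule ℝ E} (hG : G.FG) {δ : ℝ} (hδ : 0 < δ) :
    ∃ s : Finset (E →L[ℝ] ℝ), ∀ w, (∀ f ∈ s, f w = 0) → ∀ y ∈ G, (1 - δ) * ‖y‖ ≤ ‖y + w‖ := by
  classical
  have : Module.Finite ℝ G := Module.Finite.iff_fg.2 hG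
  have := FiniteDimensional.proper ℝ G
  obtain ⟨t, hts, htf, ht⟩ := (isCompact_sphere (0 : G) 1).finite_cover_balls hδ
  have hdual : ∀ x : G, ∃ f : E →L[ℝ] ℝ, ‖f‖ ≤ 1 ∧ f x = ‖x‖ := fun x => by
    obtain ⟨f, hf, hfx⟩ := exists_dual_vector'' ℝ (x : E)
    exact ⟨f, hf, by simpa using hfx⟩
  choose φ hφ hφx using hdual
  refine ⟨htf.toFinset.image φ, fun w hw y hy => ?_⟩
  rcases eq_or_ne y 0 with rfl | hy0
  · simp
  have hn : 0 < ‖y‖ := norm_pos_iff.2 hy0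
  set z : G := ‖y‖⁻¹ • ⟨y, hy⟩ with hz
  have hz1 : ‖z‖ = 1 := by
    rw [hz, norm_smul, norm_inv, norm_norm]
    exact inv_mul_cancel₀ hn.ne'
  obtain ⟨x, hx, hzx⟩ := Set.mem_iUnion₂.1 (ht (show z ∈ Metric.sphere 0 1 by simpa using hz1))
  have hx1 : ‖x‖ = 1 := by simpa using hts hx
  have hw0 : φ x w = 0 := hw _ (Finset.mem_image_of_mem _ (htf.mem_toFinset.2 hx))
  have hle : ∀ v, |φ x v| ≤ ‖v‖ := fun v => by
    have := (φ x).le_opNorm v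
    have := mul_le_mul_of_nonneg_right (hφ x) (norm_nonneg v)
    rw [Real.norm_eq_abs] at *
    linarith
  have h1 : φ x z = φ x x - φ x (x - z : E) := by simp
  have h2 : 1 - δ ≤ φ x z := by
    have h3 := (abs_le.1 (hle (x - z : E))).2
    have h4 : ‖(x - z : E)‖ < δ := by
      rw [Metric.mem_ball, dist_comm, dist_eq_norm] at hzx
      exact hzx
    rw [h1, hφx, hx1]
    linarith
  have h5 : φ x (y + w) = ‖y‖ * φ x z := by
    rw [map_add, hw0, hz]
    simp
    field_simp
  calc (1 - δ) * ‖y‖ ≤ φ x z * ‖y‖ := by gcongr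
    _ = φ x (y + w) := by rw [h5, mul_comm]
    _ ≤ ‖y + w‖ := (abs_le.1 (hle _)).2

/-- Every infinite dimensional space contains a normalized basic sequence, with basis constant at
most `2`. -/
theorem exists_basic_sequence {Y : Submodule ℝ E} (hY : ¬ Y.FG) :
    ∃ e : ℕ → E, (∀ n, e n ∈ Y) ∧ (∀ n, ‖e n‖ = 1) ∧ ∀ (a : ℕ →₀ ℝ) (m : ℕ),
      ‖∑ n ∈ Finset.range m, a n • e n‖ ≤ 2 * ‖Finsupp.linearCombination ℝ e a‖ := by
  classical
  -- the first component is an index, at least `n` at the `n`-th step, that controls the loss of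
  -- norm; the last one is a subspace containing the vectors chosen before
  obtain ⟨u, hu, hr⟩ := exists_seq_of_forall_finset_exists
    (fun x : ℕ × E × Submodule ℝ E => x.2.1 ∈ Y ∧ ‖x.2.1‖ = 1 ∧
      ∀ y ∈ x.2.2, ∀ b : ℝ, (1 - (1 / 2) ^ (x.1 + 2)) * ‖y‖ ≤ ‖y + b • x.2.1‖)
    (fun x z => x.1 < z.1 ∧ x.2.1 ∈ z.2.2) (by
      intro s _
      set i := s.sup (fun x => x.1) + 1
      have hG : (Submodule.span ℝ (s.image fun x => x.2.1 : Set E)).FG := ⟨_, rfl⟩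
      obtain ⟨t, ht⟩ := exists_finset_dual_almost_norming hG
        (show 0 < (1 / 2 : ℝ) ^ (i + 2) by positivity)
      obtain ⟨Y', hle, hfg, h⟩ := Submodule.not_fg_inf_ker hY t
      obtain ⟨y, hy, hy1⟩ := Submodule.exists_norm_eq_one hfg
      refine ⟨(i, y, _), ⟨hle hy, hy1, fun z hz b => ht _ (fun f hf => ?_) z hz⟩,
        fun x hx => ⟨?_, ?_⟩⟩
      · exact h f hf _ (Y'.smul_mem _ hy)
      · exact Nat.lt_succ_of_le (Finset.le_sup (f := fun x => x.1) hx)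
      · exact Submodule.subset_span (Finset.mem_image_of_mem _ hx))
  have hidx : StrictMono fun n => (u n).1 := fun m n hmn => (hr m n hmn).1
  refine ⟨fun n => (u n).2.1, fun n => (hu n).1, fun n => (hu n).2.1, fun a m => ?_⟩
  set s : ℕ → E := fun m => ∑ n ∈ Finset.range m, a n • (u n).2.1 with hs
  have hstep : ∀ M, (1 - (1 / 2) ^ (M + 2)) * ‖s M‖ ≤ ‖s (M + 1)‖ := by
    intro M
    have h1 : s M ∈ (u M).2.2 := Submodule.sum_mem _ fun n hn =>
      Submodule.smul_mem _ _ (hr n M (Finset.mem_range.1 hn)).2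
    have h2 := (hu M).2.2 _ h1 (a M)
    have h3 : s (M + 1) = s M + a M • (u M).2.1 := Finset.sum_range_succ _ _
    rw [h3]
    refine le_trans ?_ h2
    have : (1 / 2 : ℝ) ^ ((u M).1 + 2) ≤ (1 / 2) ^ (M + 2) :=
      pow_le_pow_of_le_one (by norm_num) (by norm_num)
        (Nat.add_le_add_right (hidx.le_apply (x := M)) 2)
    gcongr
  -- the product of the factors `1 - 2 ^ -(k + 2)` over `m ≤ k < M` is at least
  -- `1 / 2 + 2 ^ -(M + 1)`
  have hprod : ∀ M, m ≤ M → (1 / 2 + (1 / 2) ^ (M + 1)) * ‖s m‖ ≤ ‖s M‖ := by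
    intro M hM
    induction M, hM using Nat.le_induction with
    | base =>
      have : (1 / 2 : ℝ) ^ (m + 1) ≤ 1 / 2 := by
        rw [pow_succ]
        have := pow_le_one₀ (n := m) (show (0 : ℝ) ≤ 1 / 2 by norm_num) (by norm_num)
        linarith
      nlinarith [norm_nonneg (s m)]
    | succ M hM ih =>
      refine le_trans ?_ (hstep M)
      have h1 : (1 / 2 : ℝ) ^ (M + 1) ≤ 1 / 2 := by
        rw [pow_succ]
        have := pow_le_one₀ (n := M) (show (0 : ℝ) ≤ 1 / 2 by norm_num) (by norm_num)
        linarith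
      have h2 : (1 / 2 : ℝ) ^ (M + 2) = (1 / 2) ^ (M + 1) / 2 := by rw [pow_succ]; ring
      have h3 : (0 : ℝ) < (1 / 2) ^ (M + 1) := by positivity
      rw [show M + 1 + 1 = M + 2 from rfl, h2]
      set q := (1 / 2 : ℝ) ^ (M + 1)
      calc (1 / 2 + q / 2) * ‖s m‖ ≤ (1 - q / 2) * ((1 / 2 + q) * ‖s m‖) := by
            rw [← mul_assoc]
            refine mul_le_mul_of_nonneg_right ?_ (norm_nonneg _)
            nlinarith
        _ ≤ (1 - q / 2) * ‖s M‖ := mul_le_mul_of_nonneg_left ih (by linarith)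
  set M := max m (a.support.sup id + 1)
  have hM : Finsupp.linearCombination ℝ (fun n => (u n).2.1) a = s M := by
    rw [Finsupp.linearCombination_apply, Finsupp.sum_of_support_subset a _ _ (by simp)]
    intro k hk
    have := Finset.le_sup (f := id) hk
    simp only [id, Finset.mem_range, M, lt_max_iff] at *
    omega
  rw [hM]
  have h1 := hprod M (le_max_left _ _)
  have h2 : (0 : ℝ) < (1 / 2) ^ (M + 1) := by positivity
  have h3 := mul_nonneg h2.le (norm_nonneg (s m))
  change ‖s m‖ ≤ _
  linarith

theorem abs_coeff_le_of_basic {e : ℕ → E} (he : ∀ n, ‖e n‖ = 1)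
    (h : ∀ (a : ℕ →₀ ℝ) (m : ℕ),
      ‖∑ n ∈ Finset.range m, a n • e n‖ ≤ 2 * ‖Finsupp.linearCombination ℝ e a‖)
    (a : ℕ →₀ ℝ) (n : ℕ) : |a n| ≤ 4 * ‖Finsupp.linearCombination ℝ e a‖ := by
  have h1 : a n • e n =
      ∑ k ∈ Finset.range (n + 1), a k • e k - ∑ k ∈ Finset.range n, a k • e k := by
    rw [Finset.sum_range_succ]; simp
  have h2 : |a n| = ‖a n • e n‖ := by rw [norm_smul, he, mul_one, Real.norm_eq_abs]
  rw [h2, h1]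
  refine (norm_sub_le _ _).trans ?_
  linarith [h a n, h a (n + 1)]

/-- For basis constant `2`, the projections onto intervals have norm at most `4`, being differences
of two partial sum projections. -/
theorem norm_interval_le_of_basic {e : ℕ → E}
    (h : ∀ (a : ℕ →₀ ℝ) (m : ℕ),
      ‖∑ n ∈ Finset.range m, a n • e n‖ ≤ 2 * ‖Finsupp.linearCombination ℝ e a‖)
    (a : ℕ →₀ ℝ) (I : Set ℕ) [DecidablePred (· ∈ I)] (hI : I.OrdConnected) :
    ‖∑ n ∈ a.support with n ∈ I, a n • e n‖ ≤ 4 * ‖Finsupp.linearCombination ℝ e a‖ := by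
  rcases (a.support.filter (· ∈ I)).eq_empty_or_nonempty with hs | hs
  · rw [hs]; simp
  set s := a.support.filter (· ∈ I) with hsdef
  have key : ∑ n ∈ s, a n • e n = ∑ n ∈ Finset.range (s.max' hs + 1), a n • e n -
      ∑ n ∈ Finset.range (s.min' hs), a n • e n := by
    have hle : s.min' hs ≤ s.max' hs + 1 :=
      (s.min'_le _ (s.max'_mem hs)).trans (Nat.le_succ _)
    rw [← Finset.sum_Ico_eq_sub _ hle]
    refine Finset.sum_subset (fun n hn => ?_) (fun n hn hns => ?_)
    · exact Finset.mem_Ico.2 ⟨s.min'_le n hn, Nat.lt_succ_of_le (s.le_max' n hn)⟩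
    · rw [Finset.mem_Ico] at hn
      have hnI : n ∈ I := hI.out (Finset.mem_filter.1 (s.min'_mem hs)).2
        (Finset.mem_filter.1 (s.max'_mem hs)).2 ⟨hn.1, Nat.le_of_lt_succ hn.2⟩
      have : a n = 0 := by
        by_contra h0
        exact hns (Finset.mem_filter.2 ⟨Finsupp.mem_support_iff.2 h0, hnI⟩)
      rw [this, zero_smul]
  rw [key]
  refine (norm_sub_le _ _).trans ?_
  linarith [h a (s.max' hs + 1), h a (s.min' hs)]

end InfiniteDimensional

/-! ### The tree space -/

/-- A set of nodes is convex if it contains, with two comparable nodes, all the nodes between. The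
nodes of the tree are finite sequences listed in reverse, so that the children of `t` are the nodes
`i :: t`, and the tree order is the suffix order `<:+`. -/
def NodeConvex (R : Set (List ℕ)) : Prop :=
  ∀ ⦃s t u : List ℕ⦄, s <:+ t → t <:+ u → s ∈ R → u ∈ R → t ∈ R

/-- A family of pairwise incomparable segments of the tree `List ℕ`, encoded as a partial colouring
of the nodes: the segments are the colour classes. Which colours are used does not matter. -/
structure SegmentFamily where
  /-- The colour of a node, if it lies on one of the segments. -/
  color : List ℕ → Option (List ℕ)
  color_eq_iff : ∀ ⦃s t : List ℕ⦄, (color s).isSome → (color t).isSome →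
    (color s = color t ↔ s <:+ t ∨ t <:+ s)
  convex : NodeConvex {s | (color s).isSome}

open Classical in
/-- The trace of a segment family on a convex set of nodes. -/
noncomputable def SegmentFamily.restrict (D : SegmentFamily) {R : Set (List ℕ)}
    (hR : NodeConvex R) : SegmentFamily where
  color s := if s ∈ R then D.color s else none
  color_eq_iff s t hs ht := by
    by_cases h1 : s ∈ R <;> by_cases h2 : t ∈ R <;> simp [h1, h2] at hs ht ⊢
    exact D.color_eq_iff hs ht
  convex s t u hst htu hs hu := by
    by_cases h1 : s ∈ R <;> by_cases h2 : u ∈ R <;> simp [h1, h2] at hs hu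
    have h3 : t ∈ R := hR hst htu h1 h2
    simpa [h3] using D.convex hst htu hs hu

section TreeSpace

variable {V : Type*} [NormedAddCommGroup V] {p : ℝ≥0∞}

/-- The ambient space of the tree spaces. The component of a vector at a segment family is an
`ℓ_p`-sum over the segments of the family. -/
abbrev TreeSpace (V : Type*) [NormedAddCommGroup V] (p : ℝ≥0∞) [Fact (1 ≤ p)] : Type _ :=
  lp (fun _ : SegmentFamily => lp (fun _ : List ℕ => V) p) ⊤

/-- The vector `v` placed at the colour `o`, zero if there is none. -/
noncomputable def colorVec (p : ℝ≥0∞) (o : Option (List ℕ)) (v : V) : lp (fun _ : List ℕ => V) p :=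
  o.elim 0 fun j => lp.single p j v

@[simp] theorem colorVec_none (v : V) : colorVec p none v = 0 := rfl

@[simp] theorem colorVec_some (j : List ℕ) (v : V) : colorVec p (some j) v = lp.single p j v := rfl

variable [hp1 : Fact (1 ≤ p)]

theorem norm_colorVec_le (o : Option (List ℕ)) (v : V) : ‖colorVec p o v‖ ≤ ‖v‖ := by
  cases o with
  | none => simp
  | some j => exact (lp.norm_single (E := fun _ => V) (zero_lt_one.trans_le hp1.out) j v).le

/-- The basis vector of the tree space at the node `s`, for the tree space built on the sequence
`e`. For finitely many coefficients `x s`, the norm of `∑ x s • treeVec p e s` is the supremum over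
the families of incomparable segments `S` of the `ℓ_p`-norm of `‖∑ s ∈ S, x s • e s.length‖`. -/
noncomputable def treeVec (p : ℝ≥0∞) [hp1 : Fact (1 ≤ p)] (e : ℕ → V) (s : List ℕ) :
    TreeSpace V p :=
  ⟨fun D => colorVec p (D.color s) (e s.length), memℓp_infty ⟨‖e s.length‖, by
    rintro _ ⟨D, rfl⟩
    exact norm_colorVec_le _ _⟩⟩

theorem treeVec_apply (e : ℕ → V) (s : List ℕ) (D : SegmentFamily) :
    treeVec p e s D = colorVec p (D.color s) (e s.length) := rfl

variable [NormedSpace ℝ V]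

/-- Restriction of vectors of the tree space to a convex set of nodes. -/
noncomputable def nodeProj {R : Set (List ℕ)} (hR : NodeConvex R) :
    TreeSpace V p →L[ℝ] TreeSpace V p :=
  LinearMap.mkContinuous
    { toFun := fun F => ⟨fun D => F (D.restrict hR), memℓp_infty ⟨‖F‖, by
        rintro _ ⟨D, rfl⟩
        exact lp.norm_apply_le_norm ENNReal.top_ne_zero F _⟩⟩
      map_add' := fun F G => rfl
      map_smul' := fun c F => rfl } 1 (fun F => by
        rw [one_mul]
        exact lp.norm_le_of_forall_le (norm_nonneg _) fun D =>
          lp.norm_apply_le_norm ENNReal.top_ne_zero F _)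

theorem nodeProj_apply {R : Set (List ℕ)} (hR : NodeConvex R) (F : TreeSpace V p)
    (D : SegmentFamily) : nodeProj hR F D = F (D.restrict hR) := rfl

theorem norm_nodeProj_le {R : Set (List ℕ)} (hR : NodeConvex R) (F : TreeSpace V p) :
    ‖nodeProj hR F‖ ≤ ‖F‖ :=
  lp.norm_le_of_forall_le (norm_nonneg _) fun _ =>
    lp.norm_apply_le_norm ENNReal.top_ne_zero F _

theorem nodeProj_treeVec_of_mem {R : Set (List ℕ)} (hR : NodeConvex R) (e : ℕ → V) {s : List ℕ}
    (hs : s ∈ R) : nodeProj hR (treeVec p e s) = treeVec p e s := by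
  refine lp.ext (funext fun D => ?_)
  rw [nodeProj_apply, treeVec_apply, treeVec_apply]
  simp [SegmentFamily.restrict, hs]

theorem nodeProj_treeVec_of_notMem {R : Set (List ℕ)} (hR : NodeConvex R) (e : ℕ → V)
    {s : List ℕ} (hs : s ∉ R) : nodeProj hR (treeVec p e s) = 0 := by
  refine lp.ext (funext fun D => ?_)
  rw [nodeProj_apply, treeVec_apply]
  simp [SegmentFamily.restrict, hs]

theorem treeSpace_linearCombination_apply (z : ℕ → TreeSpace V p) (a : ℕ →₀ ℝ)
    (D : SegmentFamily) :
    Finsupp.linearCombination ℝ z a D = Finsupp.linearCombination ℝ (fun k => z k D) a := by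
  rw [lp_linearCombination_apply, Finsupp.linearCombination_apply]
  rfl

/-! ### Branches -/

theorem eq_of_suffix_branch {b : ℕ → List ℕ} (hb : ∀ m n, m ≤ n → b m <:+ b n)
    (hlen : ∀ n, (b n).length = n) {t : List ℕ} {n : ℕ} (ht : t <:+ b n) : t = b t.length := by
  have hle : t.length ≤ n := by simpa [hlen] using ht.length_le
  have h := List.suffix_of_suffix_length_le ht (hb _ _ hle) (by rw [hlen])
  exact h.eq_of_length (by rw [hlen])

/-- All the nodes of a branch form a single segment. -/
noncomputable def SegmentFamily.branch {b : ℕ → List ℕ} (hb : ∀ m n, m ≤ n → b m <:+ b n)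
    (hlen : ∀ n, (b n).length = n) : SegmentFamily :=
  open Classical in
  { color := fun s => if s ∈ Set.range b then some [] else none
    color_eq_iff := by
      intro s t hs ht
      have hs' : s ∈ Set.range b := by by_contra h; simp [h] at hs
      have ht' : t ∈ Set.range b := by by_contra h; simp [h] at ht
      rw [if_pos hs', if_pos ht']
      obtain ⟨m, rfl⟩ := hs'
      obtain ⟨n, rfl⟩ := ht'
      simpa using (le_total m n).imp (hb m n) (hb n m)
    convex := by
      intro s t u _ htu _ hu
      have hu' : u ∈ Set.range b := by
        by_contra h
        simp only [Set.mem_ofPred_eq, h, if_false] at hu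
        simp at hu
      obtain ⟨n, rfl⟩ := hu'
      have ht : t ∈ Set.range b := ⟨_, (eq_of_suffix_branch hb hlen htu).symm⟩
      obtain ⟨m, rfl⟩ := ht
      simp }

/-- Along a branch of the tree, the basis vectors of the tree space are equivalent to the basic
sequence on which it is built. -/
theorem equivalentSequences_branch {e : ℕ → V}
    (h : ∀ (a : ℕ →₀ ℝ) (m : ℕ),
      ‖∑ n ∈ Finset.range m, a n • e n‖ ≤ 2 * ‖Finsupp.linearCombination ℝ e a‖)
    {b : ℕ → List ℕ} (hb : ∀ m n, m ≤ n → b m <:+ b n) (hlen : ∀ n, (b n).length = n) :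
    EquivalentSequences e fun n => treeVec p e (b n) := by
  classical
  have h0 : 0 < p := zero_lt_one.trans_le hp1.out
  have hsum : ∀ (s : Finset ℕ) (a : ℕ →₀ ℝ) (j : List ℕ),
      ∑ n ∈ s, a n • lp.single (E := fun _ => V) p j (e n) =
        lp.single (E := fun _ => V) p j (∑ n ∈ s, a n • e n) := by
    intro s a j
    have := map_sum (lp.lsingle (𝕜 := ℝ) (E := fun _ : List ℕ => V) p j) (fun n => a n • e n) s
    simp only [lp.lsingle_apply, lp.single_smul] at this
    exact this.symm
  refine ⟨1, 4, one_pos, fun a => ⟨?_, ?_⟩⟩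
  · rw [one_mul]
    refine le_trans (le_of_eq ?_) (lp.norm_apply_le_norm ENNReal.top_ne_zero _
      (SegmentFamily.branch hb hlen))
    rw [treeSpace_linearCombination_apply, Finsupp.linearCombination_apply, Finsupp.sum,
      Finsupp.linearCombination_apply, Finsupp.sum]
    have : ∀ n, treeVec p e (b n) (SegmentFamily.branch hb hlen) =
        lp.single (E := fun _ => V) p [] (e n) := by
      intro n
      rw [treeVec_apply, hlen]
      have : (SegmentFamily.branch hb hlen).color (b n) = some [] := by
        simp [SegmentFamily.branch]
      rw [this, colorVec_some]
    simp only [this]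
    rw [hsum, lp.norm_single h0]
  · refine lp.norm_le_of_forall_le (by positivity) fun D => ?_
    rw [treeSpace_linearCombination_apply, Finsupp.linearCombination_apply, Finsupp.sum]
    set I : Set ℕ := {n | (D.color (b n)).isSome} with hI
    have hIc : I.OrdConnected := ⟨fun m hm n hn k hk =>
      D.convex (hb _ _ hk.1) (hb _ _ hk.2) hm hn⟩
    obtain ⟨j, hj⟩ : ∃ j, ∀ n ∈ I, D.color (b n) = some j := by
      by_cases hne : I.Nonempty
      · obtain ⟨m, hm⟩ := hne
        obtain ⟨j, hj⟩ := Option.isSome_iff_exists.1 hm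
        refine ⟨j, fun n hn => ?_⟩
        rw [← hj]
        exact (D.color_eq_iff hn hm).2 ((le_total n m).imp (hb _ _) (hb _ _))
      · exact ⟨[], fun n hn => (hne ⟨n, hn⟩).elim⟩
    have key : ∑ n ∈ a.support, a n • treeVec p e (b n) D =
        ∑ n ∈ a.support with n ∈ I, a n • lp.single (E := fun _ => V) p j (e n) := by
      rw [Finset.sum_filter]
      refine Finset.sum_congr rfl fun n _ => ?_
      rw [treeVec_apply, hlen]
      by_cases hn : n ∈ I
      · rw [if_pos hn, hj n hn, colorVec_some]
      · have : D.color (b n) = none := by simpa [hI] using hn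
        rw [if_neg hn, this, colorVec_none, smul_zero]
    rw [key, hsum, lp.norm_single h0]
    exact norm_interval_le_of_basic h a I hIc

/-! ### Incomparable blocks -/

theorem exists_color_of_apply_ne_zero {e : ℕ → V} {B : Set (List ℕ)} {z : TreeSpace V p}
    (hz : z ∈ Submodule.span ℝ (treeVec p e '' B)) {D : SegmentFamily} {j : List ℕ}
    (h : z D j ≠ 0) : ∃ s ∈ B, D.color s = some j := by
  by_contra! hne
  refine h ?_
  clear h
  induction hz using Submodule.span_induction with
  | mem x hx =>
    obtain ⟨s, hs, rfl⟩ := hx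
    rw [treeVec_apply]
    rcases hc : D.color s with _ | i
    · rfl
    · have : j ≠ i := by rintro rfl; exact hne s hs hc
      exact lp.single_apply_ne p i _ this
  | zero => rfl
  | add x y _ _ hx hy =>
    have : (x + y) D j = x D j + y D j := rfl
    rw [this, hx, hy, add_zero]
  | smul c x _ hx =>
    have : (c • x) D j = c • x D j := rfl
    rw [this, hx, smul_zero]

/-- Convex blocks of nodes such that nodes in different blocks are incomparable (in particular, the
blocks are disjoint). -/
structure SeparatedBlocks (B : ℕ → Set (List ℕ)) : Prop where
  eq_of_suffix : ∀ ⦃k l s t⦄, s ∈ B k → t ∈ B l → s <:+ t → k = l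
  convex : ∀ k, NodeConvex (B k)

open Classical in
/-- On each block, take the segments of a family given for that block. The colours are relabelled
to be distinct on different blocks. -/
noncomputable def SegmentFamily.glue {B : ℕ → Set (List ℕ)} (hB : SeparatedBlocks B)
    (D : ℕ → SegmentFamily) : SegmentFamily :=
  have hcol : ∀ {s k}, s ∈ B k → (if h : ∃ k, s ∈ B k then
      ((D h.choose).color s).map (h.choose :: ·) else none) = ((D k).color s).map (k :: ·) := by
    intro s k hk
    have h : ∃ k, s ∈ B k := ⟨k, hk⟩
    have := hB.eq_of_suffix h.choose_spec hk List.suffix_rfl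
    rw [dif_pos h, this]
  { color := fun s => if h : ∃ k, s ∈ B k then
      ((D h.choose).color s).map (h.choose :: ·) else none
    color_eq_iff := by
      intro s t hs ht
      have hs' : ∃ k, s ∈ B k := by by_contra h; simp [h] at hs
      have ht' : ∃ k, t ∈ B k := by by_contra h; simp [h] at ht
      obtain ⟨k, hk⟩ := hs'
      obtain ⟨l, hl⟩ := ht'
      rw [hcol hk, hcol hl]
      rw [hcol hk, Option.isSome_map] at hs
      rw [hcol hl, Option.isSome_map] at ht
      constructor
      · intro h
        obtain ⟨i, hi⟩ := Option.isSome_iff_exists.1 hs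
        obtain ⟨j, hj⟩ := Option.isSome_iff_exists.1 ht
        rw [hi, hj, Option.map_some, Option.map_some, Option.some_inj, List.cons_eq_cons] at h
        obtain ⟨rfl, rfl⟩ := h
        exact ((D k).color_eq_iff hs ht).1 (hi.trans hj.symm)
      · intro h
        have hkl : k = l := h.elim (hB.eq_of_suffix hk hl)
          fun h => (hB.eq_of_suffix hl hk h).symm
        subst hkl
        rw [((D k).color_eq_iff hs ht).2 h]
    convex := by
      intro s t u hst htu hs hu
      rw [Set.mem_ofPred_eq] at hs hu ⊢
      have hs' : ∃ k, s ∈ B k := by by_contra h; rw [dif_neg h] at hs; simp at hs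
      have hu' : ∃ k, u ∈ B k := by by_contra h; rw [dif_neg h] at hu; simp at hu
      obtain ⟨k, hk⟩ := hs'
      obtain ⟨l, hl⟩ := hu'
      have hkl := hB.eq_of_suffix hk hl (hst.trans htu)
      subst hkl
      rw [hcol (hB.convex k hst htu hk hl), Option.isSome_map]
      rw [hcol hk, Option.isSome_map] at hs
      rw [hcol hl, Option.isSome_map] at hu
      exact (D k).convex hst htu hs hu }

theorem SegmentFamily.glue_color {B : ℕ → Set (List ℕ)} (hB : SeparatedBlocks B)
    (D : ℕ → SegmentFamily) {k : ℕ} {s : List ℕ} (hs : s ∈ B k) :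
    (SegmentFamily.glue hB D).color s = ((D k).color s).map (k :: ·) := by
  have h : ∃ k, s ∈ B k := ⟨k, hs⟩
  have := hB.eq_of_suffix h.choose_spec hs List.suffix_rfl
  simp only [SegmentFamily.glue]
  rw [dif_pos h, this]

theorem glue_apply {e : ℕ → V} {B : ℕ → Set (List ℕ)} (hB : SeparatedBlocks B)
    (D : ℕ → SegmentFamily) {k : ℕ} {z : TreeSpace V p}
    (hz : z ∈ Submodule.span ℝ (treeVec p e '' B k)) (j : List ℕ) :
    z (SegmentFamily.glue hB D) (k :: j) = z (D k) j := by
  induction hz using Submodule.span_induction with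
  | mem x hx =>
    obtain ⟨s, hs, rfl⟩ := hx
    rw [treeVec_apply, treeVec_apply, SegmentFamily.glue_color hB D hs]
    rcases (D k).color s with _ | i
    · rfl
    · simp [Pi.single_apply]
  | zero => rfl
  | add x y _ _ hx hy => exact congrArg₂ (· + ·) hx hy
  | smul c x _ hx => exact congrArg (c • ·) hx

/-- Vectors supported on separated blocks behave like multiples of the unit vectors of `ℓ_p`: no
segment meets two of the blocks, and segment families chosen for the single blocks can be glued. -/
theorem norm_linearCombination_blocks {e : ℕ → V} {B : ℕ → Set (List ℕ)} (hB : SeparatedBlocks B)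
    {z : ℕ → TreeSpace V p} (hz : ∀ k, z k ∈ Submodule.span ℝ (treeVec p e '' B k)) {c C : ℝ}
    (hc : 0 < c) (hC : 0 ≤ C) (hzc : ∀ k, c ≤ ‖z k‖) (hzC : ∀ k, ‖z k‖ ≤ C) (a : ℕ →₀ ℝ) :
    c / 2 * ‖Finsupp.linearCombination ℝ (lpUnit p) a‖ ≤ ‖Finsupp.linearCombination ℝ z a‖ ∧
      ‖Finsupp.linearCombination ℝ z a‖ ≤ C * ‖Finsupp.linearCombination ℝ (lpUnit p) a‖ := by
  have hdisj : ∀ D : SegmentFamily, ∀ j k l, z k D j ≠ 0 → z l D j ≠ 0 → k = l := by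
    intro D j k l hk hl
    obtain ⟨s, hs, hsj⟩ := exists_color_of_apply_ne_zero (hz k) hk
    obtain ⟨t, ht, htj⟩ := exists_color_of_apply_ne_zero (hz l) hl
    rcases (D.color_eq_iff (by simp [hsj]) (by simp [htj])).1 (hsj.trans htj.symm) with h | h
    · exact hB.eq_of_suffix hs ht h
    · exact (hB.eq_of_suffix ht hs h).symm
  constructor
  · have hD : ∀ k, ∃ D, c / 2 ≤ ‖z k D‖ := by
      intro k
      by_contra! h
      have := lp.norm_le_of_forall_le (half_pos hc).le fun D => (h D).le
      linarith [hzc k]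
    choose D hD using hD
    refine le_trans ?_ (lp.norm_apply_le_norm ENNReal.top_ne_zero _ (SegmentFamily.glue hB D))
    rw [treeSpace_linearCombination_apply]
    refine le_norm_linearCombination_of_disjoint (hdisj _) (half_pos hc).le (fun k => ?_) a
    exact (hD k).trans (lp_norm_le_of_injective (List.cons_injective (a := k))
      (glue_apply hB D (hz k)))
  · refine lp.norm_le_of_forall_le (by positivity) fun D => ?_
    rw [treeSpace_linearCombination_apply]
    exact norm_linearCombination_le_of_disjoint (hdisj D) hC (fun k =>
      (lp.norm_apply_le_norm ENNReal.top_ne_zero (z k) D).trans (hzC k)) a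

end TreeSpace

/-! ### Well-founded trees -/

section WellFounded

theorem NodeConvex.of_upward {R : Set (List ℕ)} (h : ∀ ⦃s t : List ℕ⦄, s <:+ t → s ∈ R → t ∈ R) :
    NodeConvex R := fun _ _ _ hst _ hs _ => h hst hs

theorem nodeConvex_above (t : List ℕ) : NodeConvex {s | t <:+ s} :=
  NodeConvex.of_upward fun _ _ hst hs => List.IsSuffix.trans hs hst

theorem nodeConvex_singleton (t : List ℕ) : NodeConvex {t} := by
  rintro s r u hsr hru rfl rfl
  exact hru.eq_of_length (le_antisymm hru.length_le hsr.length_le)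

/-- The nodes above the children `i :: t` of `t` with `i ∈ I`. -/
def childBlock (t : List ℕ) (I : Set ℕ) : Set (List ℕ) := {s | ∃ i ∈ I, (i :: t) <:+ s}

theorem nodeConvex_childBlock (t : List ℕ) (I : Set ℕ) : NodeConvex (childBlock t I) :=
  NodeConvex.of_upward fun _ _ hst ⟨i, hi, hs⟩ => ⟨i, hi, hs.trans hst⟩

theorem child_eq_of_suffix {t s : List ℕ} {i j : ℕ} (hi : (i :: t) <:+ s) (hj : (j :: t) <:+ s) :
    i = j := by
  have h := (List.suffix_of_suffix_length_le hi hj (by simp)).eq_of_length (by simp)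
  exact (List.cons_eq_cons.1 h).1

theorem not_cons_suffix (i : ℕ) (t : List ℕ) : ¬ (i :: t) <:+ t := by
  intro h
  have := h.length_le
  simp at this

theorem exists_cons_suffix {t s : List ℕ} (h : t <:+ s) (hne : s ≠ t) : ∃ i, (i :: t) <:+ s := by
  obtain ⟨r, rfl⟩ := h
  rcases List.eq_nil_or_concat r with rfl | ⟨q, i, rfl⟩
  · simp at hne
  · exact ⟨i, q, by simp⟩

theorem separatedBlocks_childBlock (t : List ℕ) {N : ℕ → ℕ} (hN : Monotone N) :
    SeparatedBlocks fun k => childBlock t (Set.Ico (N k) (N (k + 1))) where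
  eq_of_suffix := by
    rintro k l s u ⟨i, hi, his⟩ ⟨j, hj, hju⟩ hsu
    have hij := child_eq_of_suffix (his.trans hsu) hju
    subst hij
    rw [Set.mem_Ico] at hi hj
    by_contra hkl
    rcases lt_or_gt_of_ne hkl with h | h
    · have := hN (Nat.succ_le_of_lt h)
      simp only [Nat.succ_eq_add_one] at this
      omega
    · have := hN (Nat.succ_le_of_lt h)
      simp only [Nat.succ_eq_add_one] at this
      omega
  convex k := nodeConvex_childBlock t _

variable {V : Type*} [NormedAddCommGroup V] [NormedSpace ℝ V] {p : ℝ≥0∞} [hp1 : Fact (1 ≤ p)]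

/-- The tree space of the set of nodes `T`, built on the sequence `e`. -/
noncomputable def treeSubspace (p : ℝ≥0∞) [hp1 : Fact (1 ≤ p)] (e : ℕ → V) (T : Set (List ℕ)) :
    Submodule ℝ (TreeSpace V p) :=
  (Submodule.span ℝ (treeVec p e '' T)).topologicalClosure

theorem treeSubspace_mono (e : ℕ → V) {T T' : Set (List ℕ)} (h : T ⊆ T') :
    treeSubspace p e T ≤ treeSubspace p e T' :=
  Submodule.topologicalClosure_mono (Submodule.span_mono (Set.image_mono h))

theorem eq_on_treeSubspace {W : Type*} [NormedAddCommGroup W] [NormedSpace ℝ W] {e : ℕ → V}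
    {T : Set (List ℕ)} {A B : TreeSpace V p →L[ℝ] W}
    (h : ∀ s ∈ T, A (treeVec p e s) = B (treeVec p e s)) {y : TreeSpace V p}
    (hy : y ∈ treeSubspace p e T) : A y = B y := by
  refine ContinuousLinearMap.eqOn_closure_span (s := treeVec p e '' T) ?_ hy
  rintro _ ⟨s, hs, rfl⟩
  exact h s hs

theorem not_strictlySingularOn_iff {E F : Type*} [NormedAddCommGroup E] [NormedSpace ℝ E]
    [NormedAddCommGroup F] [NormedSpace ℝ F] {S : E →L[ℝ] F} {Y : Submodule ℝ E} :
    ¬ StrictlySingularOn S Y ↔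
      ∃ Y' ≤ Y, ¬ Y'.FG ∧ ∃ c > 0, ∀ y ∈ Y', c * ‖y‖ ≤ ‖S y‖ := by
  simp only [StrictlySingularOn]
  push Not
  simp

/-- In a well-founded tree, there is a last node `t` for which the restriction to the nodes above
`t` is not strictly singular. -/
theorem exists_minimal_not_strictlySingularOn {e : ℕ → V} {T : Set (List ℕ)}
    (hT : ∀ i t, i :: t ∈ T → t ∈ T) (hwf : ¬ ∃ σ : ℕ → ℕ, ∀ n, PiNat.res σ n ∈ T)
    {Y : Submodule ℝ (TreeSpace V p)} (hY : ¬ Y.FG) (hle : Y ≤ treeSubspace p e T) :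
    ∃ t, ¬ StrictlySingularOn (nodeProj (V := V) (p := p) (nodeConvex_above t)) Y ∧
      ∀ i, StrictlySingularOn (nodeProj (V := V) (p := p) (nodeConvex_above (i :: t))) Y := by
  by_contra! hcon
  have hnil : ¬ StrictlySingularOn (nodeProj (V := V) (p := p) (nodeConvex_above [])) Y := by
    intro h
    obtain ⟨y, hy, hlt⟩ := h Y le_rfl hY 1 one_pos
    have : nodeProj (nodeConvex_above []) y = y :=
      eq_on_treeSubspace (B := ContinuousLinearMap.id ℝ _) (fun s _ =>
        nodeProj_treeVec_of_mem _ e List.nil_suffix) (hle hy)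
    rw [this, one_mul] at hlt
    exact lt_irrefl _ hlt
  have hmem : ∀ t, ¬ StrictlySingularOn (nodeProj (V := V) (p := p) (nodeConvex_above t)) Y →
      t ∈ T := by
    intro t
    contrapose!
    intro ht Y' hY' hfg c hc
    obtain ⟨y, hy, hy1⟩ := Submodule.exists_norm_eq_one hfg
    refine ⟨y, hy, ?_⟩
    have h0 : nodeProj (nodeConvex_above t) y = 0 :=
      eq_on_treeSubspace (B := 0) (fun s hs => nodeProj_treeVec_of_notMem _ e fun h => ht ?_)
        (hle (hY' hy))
    · rw [h0, hy1]; simpa using hc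
    · obtain ⟨r, rfl⟩ := h
      clear ht
      induction r with
      | nil => exact hs
      | cons i r ih => exact ih (hT _ _ hs)
  choose! f hf using hcon
  let node : ℕ → List ℕ := fun n => Nat.rec [] (fun _ t => f t :: t) n
  have hnode : ∀ n, ¬ StrictlySingularOn
      (nodeProj (V := V) (p := p) (nodeConvex_above (node n))) Y := by
    intro n
    induction n with
    | zero => exact hnil
    | succ n ih => exact hf _ ih
  refine hwf ⟨fun n => f (node n), fun n => ?_⟩
  have : PiNat.res (fun n => f (node n)) n = node n := by
    induction n with
    | zero => rfl
    | succ n ih => rw [PiNat.res_succ, ih]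
  rw [this]
  exact hmem _ (hnode n)

/-- The restriction to a single node has rank one, so it is strictly singular. -/
theorem strictlySingularOn_nodeProj_singleton {e : ℕ → V} (t : List ℕ)
    {Y : Submodule ℝ (TreeSpace V p)} (hle : Y ≤ treeSubspace p e Set.univ) :
    StrictlySingularOn (nodeProj (V := V) (p := p) (nodeConvex_singleton t)) Y := by
  intro Y' hY' hfg c hc
  set Q := nodeProj (V := V) (p := p) (nodeConvex_singleton t) with hQ
  set L : Submodule ℝ (TreeSpace V p) := Submodule.span ℝ {treeVec p e t} with hL
  have hrange : ∀ y ∈ treeSubspace p e Set.univ, Q y ∈ L := by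
    have hcl : IsClosed (L.comap (Q : TreeSpace V p →ₗ[ℝ] TreeSpace V p) : Set (TreeSpace V p)) :=
      (Submodule.closed_of_finiteDimensional L).preimage Q.continuous
    refine Submodule.topologicalClosure_minimal _ (Submodule.span_le.2 ?_) hcl
    rintro _ ⟨s, -, rfl⟩
    change Q (treeVec p e s) ∈ L
    by_cases hs : s ∈ ({t} : Set (List ℕ))
    · rw [hQ, nodeProj_treeVec_of_mem _ e hs, Set.mem_singleton_iff.1 hs]
      exact Submodule.mem_span_singleton_self _
    · rw [hQ, nodeProj_treeVec_of_notMem _ e hs]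
      exact L.zero_mem
  have hker : ¬ (Y' ⊓ LinearMap.ker (Q : TreeSpace V p →ₗ[ℝ] TreeSpace V p)).FG := by
    intro h
    refine hfg (Submodule.fg_of_fg_map_of_fg_inf_ker (Q : TreeSpace V p →ₗ[ℝ] TreeSpace V p) ?_ h)
    have hmap : Y'.map (Q : TreeSpace V p →ₗ[ℝ] TreeSpace V p) ≤ L := by
      rintro _ ⟨y, hy, rfl⟩
      exact hrange y (hle (hY' hy))
    exact Module.Finite.iff_fg.1 (Submodule.finiteDimensional_of_le hmap)
  obtain ⟨y, hy, hy1⟩ := Submodule.exists_norm_eq_one hker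
  refine ⟨y, hy.1, ?_⟩
  have : Q y = 0 := hy.2
  rw [this, hy1]
  simpa using hc

/-- The part above `t` splits into the part at `t`, the parts above the first `N` children, and the
part above the other children. -/
theorem nodeProj_above_eq {e : ℕ → V} (t : List ℕ) (N : ℕ) {y : TreeSpace V p}
    (hy : y ∈ treeSubspace p e Set.univ) :
    nodeProj (nodeConvex_above t) y = nodeProj (nodeConvex_singleton t) y +
      ∑ i ∈ Finset.range N, nodeProj (nodeConvex_above (i :: t)) y +
      nodeProj (nodeConvex_childBlock t (Set.Ici N)) y := by
  have h := eq_on_treeSubspace (e := e) (T := Set.univ) (A := nodeProj (nodeConvex_above t))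
    (B := nodeProj (V := V) (p := p) (nodeConvex_singleton t) +
      ∑ i ∈ Finset.range N, nodeProj (nodeConvex_above (i :: t)) +
      nodeProj (nodeConvex_childBlock t (Set.Ici N))) ?_ hy
  · simpa using h
  intro s _
  simp only [add_apply, sum_apply]
  by_cases hts : t <:+ s
  · rw [nodeProj_treeVec_of_mem _ e hts]
    by_cases hst : s = t
    · subst hst
      rw [nodeProj_treeVec_of_mem _ e (Set.mem_singleton s), Finset.sum_eq_zero,
        nodeProj_treeVec_of_notMem, add_zero, add_zero]
      · rintro ⟨i, -, hi⟩
        exact not_cons_suffix _ _ hi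
      · intro i _
        exact nodeProj_treeVec_of_notMem _ e (not_cons_suffix _ _)
    · obtain ⟨i, hi⟩ := exists_cons_suffix hts hst
      rw [nodeProj_treeVec_of_notMem _ e (R := {t}) hst, zero_add]
      by_cases hiN : i < N
      · rw [Finset.sum_eq_single i, nodeProj_treeVec_of_mem _ e hi, nodeProj_treeVec_of_notMem,
          add_zero]
        · rintro ⟨j, hj, hjs⟩
          have := child_eq_of_suffix hi hjs
          rw [Set.mem_Ici] at hj
          omega
        · intro j _ hji
          exact nodeProj_treeVec_of_notMem _ e fun h => hji (child_eq_of_suffix h hi)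
        · intro h
          exact (h (Finset.mem_range.2 hiN)).elim
      · rw [Finset.sum_eq_zero, nodeProj_treeVec_of_mem _ e (R := childBlock t (Set.Ici N)),
          zero_add]
        · exact ⟨i, not_lt.1 hiN, hi⟩
        · intro j hj
          refine nodeProj_treeVec_of_notMem _ e fun h => hiN ?_
          rw [child_eq_of_suffix hi h]
          exact Finset.mem_range.1 hj
  · have h1 : ∀ i, ¬ (i :: t) <:+ s := fun i h => hts ((List.suffix_cons i t).trans h)
    rw [nodeProj_treeVec_of_notMem _ e hts, nodeProj_treeVec_of_notMem _ e,
      nodeProj_treeVec_of_notMem _ e, Finset.sum_eq_zero, add_zero, add_zero]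
    · intro i _
      exact nodeProj_treeVec_of_notMem _ e (h1 i)
    · rintro ⟨i, -, h⟩
      exact h1 i h
    · rintro rfl
      exact hts List.suffix_rfl

theorem exists_nodeProj_mem_span_childBlock {e : ℕ → V} (t : List ℕ) (N : ℕ) {x : TreeSpace V p}
    (hx : x ∈ Submodule.span ℝ (treeVec p e '' Set.univ)) :
    ∃ M, N ≤ M ∧ nodeProj (nodeConvex_childBlock t (Set.Ici N)) x ∈
      Submodule.span ℝ (treeVec p e '' childBlock t (Set.Ico N M)) := by
  have hmono : ∀ M M', M ≤ M' → Submodule.span ℝ (treeVec p e '' childBlock t (Set.Ico N M)) ≤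
      Submodule.span ℝ (treeVec p e '' childBlock t (Set.Ico N M')) := by
    intro M M' h
    refine Submodule.span_mono (Set.image_mono ?_)
    rintro s ⟨i, hi, his⟩
    exact ⟨i, Set.Ico_subset_Ico_right h hi, his⟩
  induction hx using Submodule.span_induction with
  | mem x hx =>
    obtain ⟨s, -, rfl⟩ := hx
    by_cases hs : s ∈ childBlock t (Set.Ici N)
    · rw [nodeProj_treeVec_of_mem _ e hs]
      obtain ⟨i, hi, his⟩ := hs
      exact ⟨i + 1, Nat.le_succ_of_le hi,
        Submodule.subset_span ⟨s, ⟨i, ⟨hi, Nat.lt_succ_self i⟩, his⟩, rfl⟩⟩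
    · rw [nodeProj_treeVec_of_notMem _ e hs]
      exact ⟨N, le_rfl, Submodule.zero_mem _⟩
  | zero => exact ⟨N, le_rfl, by rw [map_zero]; exact Submodule.zero_mem _⟩
  | add x y _ _ hx hy =>
    obtain ⟨M, hM, hx⟩ := hx
    obtain ⟨M', hM', hy⟩ := hy
    refine ⟨max M M', hM.trans (le_max_left _ _), ?_⟩
    rw [map_add]
    exact Submodule.add_mem _ (hmono _ _ (le_max_left _ _) hx) (hmono _ _ (le_max_right _ _) hy)
  | smul c x _ hx =>
    obtain ⟨M, hM, hx⟩ := hx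
    exact ⟨M, hM, by rw [map_smul]; exact Submodule.smul_mem _ _ hx⟩

/-- The gliding hump: if the restrictions to the nodes above the children of `t` are strictly
singular, there are unit vectors whose part above `t` is almost supported on late children. -/
theorem exists_almost_mem_span_childBlock {e : ℕ → V} {t : List ℕ}
    {Y : Submodule ℝ (TreeSpace V p)} (hY : ¬ Y.FG) (hle : Y ≤ treeSubspace p e Set.univ)
    (hS : ∀ i, StrictlySingularOn (nodeProj (V := V) (p := p) (nodeConvex_above (i :: t))) Y)
    (N : ℕ) {δ : ℝ} (hδ : 0 < δ) :
    ∃ y ∈ Y, ‖y‖ = 1 ∧ ∃ M, N ≤ M ∧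
      ∃ z ∈ Submodule.span ℝ (treeVec p e '' childBlock t (Set.Ico N M)),
        ‖nodeProj (nodeConvex_above t) y - z‖ ≤ δ := by
  set ε : ℝ := δ / (N + 2) with hε
  have hε0 : 0 < ε := by positivity
  obtain ⟨Y₁, hY₁, hfg₁, h₁⟩ := exists_norm_le_of_strictlySingularOn_finset (Finset.range N) _ hY
    (fun i _ => hS i) hε0
  obtain ⟨Y₂, hY₂, hfg₂, h₂⟩ := (strictlySingularOn_nodeProj_singleton t
    (hY₁.trans hle)).exists_norm_le hfg₁ hε0
  obtain ⟨y, hy, hy1⟩ := Submodule.exists_norm_eq_one hfg₂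
  have hyc := hle (hY₁ (hY₂ hy))
  obtain ⟨x, hx, hxy⟩ := Metric.mem_closure_iff.1
    (show y ∈ closure (Submodule.span ℝ (treeVec p e '' Set.univ) : Set (TreeSpace V p)) from hyc)
    ε hε0
  obtain ⟨M, hM, hz⟩ := exists_nodeProj_mem_span_childBlock t N hx
  refine ⟨y, hY₁ (hY₂ hy), hy1, M, hM, _, hz, ?_⟩
  rw [nodeProj_above_eq t N hyc, add_sub_assoc, ← map_sub]
  have h3 : ‖∑ i ∈ Finset.range N, nodeProj (nodeConvex_above (i :: t)) y‖ ≤ N * ε := by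
    refine (norm_sum_le _ _).trans ?_
    refine (Finset.sum_le_sum fun i hi => h₁ i hi y (hY₂ hy)).trans ?_
    simp [hy1]
  have h4 := h₂ y hy
  have h5 := norm_nodeProj_le (nodeConvex_childBlock t (Set.Ici N)) (y - x)
  rw [dist_eq_norm] at hxy
  rw [hy1, mul_one] at h4
  have h6 : (N + 2) * ε = δ := by rw [hε]; field_simp
  refine (norm_add_le _ _).trans ?_
  have := norm_add_le (nodeProj (nodeConvex_singleton t) y)
    (∑ i ∈ Finset.range N, nodeProj (nodeConvex_above (i :: t)) y)
  nlinarith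

/-- Over a well-founded tree, every infinite dimensional subspace of the tree space contains a
sequence equivalent to the unit vector basis of `ℓ_p` (of `c_0` if `p = ∞`). -/
theorem exists_equivalentSequences_lpUnit {e : ℕ → V} {T : Set (List ℕ)}
    (hT : ∀ i t, i :: t ∈ T → t ∈ T) (hwf : ¬ ∃ σ : ℕ → ℕ, ∀ n, PiNat.res σ n ∈ T)
    {Y : Submodule ℝ (TreeSpace V p)} (hY : ¬ Y.FG) (hle : Y ≤ treeSubspace p e T) :
    ∃ y : ℕ → TreeSpace V p, (∀ k, y k ∈ Y) ∧ EquivalentSequences (lpUnit p) y := by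
  obtain ⟨t, ht, hS⟩ := exists_minimal_not_strictlySingularOn hT hwf hY hle
  obtain ⟨Y', hY', hfg, c, hc, hcY⟩ := not_strictlySingularOn_iff.1 ht
  set Q := nodeProj (V := V) (p := p) (nodeConvex_above t) with hQ
  have hc1 : c ≤ 1 := by
    obtain ⟨y, hy, hy1⟩ := Submodule.exists_norm_eq_one hfg
    have h1 := hcY y hy
    have h2 := norm_nodeProj_le (nodeConvex_above t) y
    rw [hy1] at h1 h2
    linarith
  -- with total error `c / 8`, half of the lower constant `c / 4` of the blocks survives
  have hstep := fun N (k : ℕ) => exists_almost_mem_span_childBlock (e := e) hfg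
    ((hY'.trans hle).trans (treeSubspace_mono e (Set.subset_univ T))) (fun i => (hS i).mono hY') N
    (show 0 < c / 16 * (1 / 2) ^ k by positivity)
  choose y hyY hy1 M hM z hz hyz using hstep
  let N : ℕ → ℕ := fun k => Nat.rec 0 (fun k n => M n k) k
  have hN : Monotone N := monotone_nat_of_le_succ fun k => hM (N k) k
  have hδ : ∀ k, c / 16 * (1 / 2 : ℝ) ^ k ≤ c / 16 := fun k =>
    mul_le_of_le_one_right (by positivity) (pow_le_one₀ (by norm_num) (by norm_num))
  have hQ1 : ∀ k, c ≤ ‖Q (y (N k) k)‖ ∧ ‖Q (y (N k) k)‖ ≤ 1 := fun k => by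
    have h1 := hcY _ (hyY (N k) k)
    have h2 := norm_nodeProj_le (nodeConvex_above t) (y (N k) k)
    rw [hy1] at h1 h2
    exact ⟨by simpa using h1, h2⟩
  have hblock := norm_linearCombination_blocks (separatedBlocks_childBlock t hN) (e := e)
    (z := fun k => z (N k) k) (fun k => hz (N k) k) (half_pos hc) zero_le_two
    (fun k => by
      have h1 := norm_sub_norm_le (Q (y (N k) k)) (z (N k) k)
      linarith [hyz (N k) k, hδ k, (hQ1 k).1])
    (fun k => by
      have h1 := norm_sub_norm_le (z (N k) k) (Q (y (N k) k))
      rw [norm_sub_rev] at h1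
      linarith [hyz (N k) k, hδ k, (hQ1 k).2])
  refine ⟨fun k => y (N k) k, fun k => hY' (hyY _ _), c / 8, 3 / c, by positivity, fun a => ?_⟩
  obtain ⟨hb1, hb2⟩ := hblock a
  set A := ‖Finsupp.linearCombination ℝ (lpUnit p) a‖ with hA
  set x := Finsupp.linearCombination ℝ (fun k => y (N k) k) a with hx
  set w := Finsupp.linearCombination ℝ (fun k => z (N k) k) a with hw
  have hA0 : 0 ≤ A := norm_nonneg _
  have hxY : x ∈ Y' := by
    rw [hx, Finsupp.linearCombination_apply]
    exact Submodule.sum_mem _ fun k _ => Submodule.smul_mem _ _ (hyY _ _)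
  have herr : ‖Q x - w‖ ≤ c / 8 * A := by
    have h1 : Q x - w = ∑ k ∈ a.support, a k • (Q (y (N k) k) - z (N k) k) := by
      simp only [hx, hw, Finsupp.linearCombination_apply, Finsupp.sum, map_sum, map_smul,
        smul_sub, Finset.sum_sub_distrib]
    rw [h1]
    calc ‖∑ k ∈ a.support, a k • (Q (y (N k) k) - z (N k) k)‖
        ≤ ∑ k ∈ a.support, ‖a k • (Q (y (N k) k) - z (N k) k)‖ := norm_sum_le _ _
      _ ≤ ∑ k ∈ a.support, A * (c / 16) * (1 / 2) ^ k := by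
          refine Finset.sum_le_sum fun k _ => ?_
          rw [norm_smul, Real.norm_eq_abs, mul_assoc]
          exact mul_le_mul (abs_apply_le_norm_linearCombination_lpUnit a k) (hyz (N k) k)
            (norm_nonneg _) hA0
      _ ≤ A * (c / 16) * 2 := by
          rw [← Finset.mul_sum]
          refine mul_le_mul_of_nonneg_left ?_ (by positivity)
          exact (summable_geometric_two.sum_le_tsum _ fun _ _ => by positivity).trans
            tsum_geometric_two.le
      _ = c / 8 * A := by ring
  have hQx := norm_nodeProj_le (nodeConvex_above t) x
  have h1 := norm_sub_norm_le w (Q x)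
  have h2 := norm_sub_norm_le (Q x) w
  rw [norm_sub_rev] at h1
  constructor
  · change ‖Q x‖ ≤ ‖x‖ at hQx
    linarith
  · rw [div_mul_eq_mul_div, le_div_iff₀ hc]
    have h3 := hcY x hxY
    have h4 : c / 8 * A ≤ A := mul_le_of_le_one_left hA0 (by linarith)
    linarith

end WellFounded

/-! ### The Borel reduction -/

section Reduction

/-- **Banach–Mazur**: every separable normed space embeds isometrically into `C(Δ)`, since its dual
ball is weak-* compact and metrizable, hence a continuous image of `Δ`. -/
theorem exists_linearIsometry_cDelta (E : Type*) [NormedAddCommGroup E] [NormedSpace ℝ E]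
    [TopologicalSpace.SeparableSpace E] : Nonempty (E →ₗᵢ[ℝ] CDelta) := by
  set K : Set (WeakDual ℝ E) := WeakDual.toStrongDual ⁻¹' Metric.closedBall 0 1
  have hK : IsCompact K := WeakDual.isCompact_closedBall 0 1
  have : CompactSpace K := isCompact_iff_compactSpace.1 hK
  have : TopologicalSpace.MetrizableSpace K := WeakDual.metrizable_of_isCompact ℝ E K hK
  let _ : MetricSpace K := TopologicalSpace.metrizableSpaceMetric K
  have : Nonempty K := ⟨⟨0, by simp [K]⟩⟩
  obtain ⟨φ, hφ, hsurj⟩ := exists_nat_bool_continuous_surjective_of_compact K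
  let J : E →ₗ[ℝ] CDelta :=
    { toFun := fun x => ⟨fun δ => (φ δ : WeakDual ℝ E) x,
        (WeakDual.eval_continuous x).comp (continuous_subtype_val.comp hφ)⟩
      map_add' := fun x y => by ext δ; simp
      map_smul' := fun c x => by ext δ; simp }
  refine ⟨⟨J, fun x => le_antisymm ?_ ?_⟩⟩
  · rw [ContinuousMap.norm_le _ (norm_nonneg _)]
    intro δ
    have h1 : ‖WeakDual.toStrongDual (φ δ : WeakDual ℝ E)‖ ≤ 1 :=
      mem_closedBall_zero_iff.1 (φ δ).2
    have h2 := (WeakDual.toStrongDual (φ δ : WeakDual ℝ E)).le_opNorm x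
    exact h2.trans (mul_le_of_le_one_left (norm_nonneg _) h1)
  · obtain ⟨f, hf, hfx⟩ := exists_dual_vector'' ℝ x
    obtain ⟨δ, hδ⟩ := hsurj ⟨StrongDual.toWeakDual f, by simpa [K] using hf⟩
    have h1 : J x δ = ‖x‖ := by
      change (φ δ : WeakDual ℝ E) x = ‖x‖
      rw [hδ]
      exact hfx
    have h2 := (J x).norm_coe_le_norm δ
    rw [h1] at h2
    simpa using h2

theorem suffix_res {σ : ℕ → ℕ} {m n : ℕ} (h : m ≤ n) : PiNat.res σ m <:+ PiNat.res σ n := by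
  induction n, h using Nat.le_induction with
  | base => exact List.suffix_rfl
  | succ n _ ih =>
    rw [PiNat.res_succ]
    exact ih.trans (List.suffix_cons _ _)

/-- An analytic set is the set of points at which a Borel family of trees is ill-founded. -/
theorem IsSigmaOneOne.exists_trees {S : Type*} [MeasurableSpace S] {B : Set S}
    (hB : IsSigmaOneOne B) :
    ∃ T : S → Set (List ℕ), (∀ u, MeasurableSet {s | u ∈ T s}) ∧
      (∀ s i t, i :: t ∈ T s → t ∈ T s) ∧ ∀ s, s ∈ B ↔ ∃ σ : ℕ → ℕ, ∀ n, PiNat.res σ n ∈ T s := by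
  obtain ⟨τ, hpol, hbor, hB⟩ := hB
  rw [MeasureTheory.AnalyticSet] at hB
  rcases hB with rfl | ⟨g, hg, rfl⟩
  · exact ⟨fun _ => ∅, fun u => by simp, by simp, by simp⟩
  refine ⟨fun s => {u | s ∈ closure (g '' {x | PiNat.res x u.length = u})},
    fun u => isClosed_closure.measurableSet, ?_, fun s => ⟨?_, ?_⟩⟩
  · intro s i t h
    refine closure_mono (Set.image_mono ?_) h
    intro x hx
    simp only [List.length_cons, Set.mem_ofPred_eq] at hx ⊢
    rw [PiNat.res_succ] at hx
    exact (List.cons_eq_cons.1 hx).2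
  · rintro ⟨σ, rfl⟩
    refine ⟨σ, fun n => subset_closure ⟨σ, ?_, rfl⟩⟩
    simp [PiNat.res_length]
  · rintro ⟨σ, hσ⟩
    refine ⟨σ, ?_⟩
    by_contra hne
    obtain ⟨K, hK, hKc, hsK⟩ := exists_mem_nhds_isClosed_subset
      (isOpen_compl_singleton.mem_nhds (show g σ ∈ ({s}ᶜ : Set S) from hne))
    obtain ⟨O, hOK, hO, hσO⟩ := mem_nhds_iff.1 hK
    obtain ⟨n, hn⟩ := PiNat.exists_disjoint_cylinder (hO.preimage hg).isClosed_compl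
      (x := σ) (by simpa using hσO)
    have hsub : closure (g '' {x | PiNat.res x (PiNat.res σ n).length = PiNat.res σ n}) ⊆ K := by
      refine closure_minimal ?_ hKc
      rintro _ ⟨x, hx, rfl⟩
      rw [PiNat.res_length] at hx
      have hxc : x ∈ PiNat.cylinder σ n := by rw [PiNat.cylinder_eq_res]; exact hx
      by_contra hxK
      exact Set.disjoint_left.1 hn (fun hxO => hxK (hOK hxO)) hxc
    exact hsK (hsub (hσ n)) rfl

/-- The closed span of a subfamily of a countable family of vectors depends measurably on the
subfamily. -/
theorem measurable_closure_span {S ι : Type*} [MeasurableSpace S] [Countable ι] (b : ι → CDelta)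
    {T : S → Set ι} (hT : ∀ u, MeasurableSet {s | u ∈ T s}) :
    Measurable fun s => ((Submodule.span ℝ (b '' T s)).closure : SB) := by
  refine measurable_generateFrom ?_
  rintro _ ⟨U, hU, rfl⟩
  have key : (fun s => ((Submodule.span ℝ (b '' T s)).closure : SB)) ⁻¹'
      {X : SB | ((X : Set CDelta) ∩ U).Nonempty} =
      ⋃ F ∈ {F : Finset ι | ((Submodule.span ℝ (b '' F) : Set CDelta) ∩ U).Nonempty},
        ⋂ u ∈ F, {s | u ∈ T s} := by
    ext s
    simp only [Set.mem_preimage, Set.mem_ofPred_eq, Set.mem_iUnion, Set.mem_iInter, exists_prop]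
    have h : (((Submodule.span ℝ (b '' T s)).closure : SB) : Set CDelta) =
      closure (Submodule.span ℝ (b '' T s) : Set CDelta) := rfl
    rw [h, closure_inter_open_nonempty_iff hU]
    constructor
    · rintro ⟨x, hx, hxU⟩
      obtain ⟨l, hl, rfl⟩ := Finsupp.mem_span_image_iff_linearCombination ℝ |>.1 hx
      exact ⟨l.support, ⟨_, (Finsupp.mem_span_image_iff_linearCombination ℝ).2
        ⟨l, (Finsupp.mem_supported ℝ l).2 subset_rfl, rfl⟩, hxU⟩, fun u hu => hl hu⟩
    · rintro ⟨F, ⟨x, hx, hxU⟩, hF⟩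
      exact ⟨x, Submodule.span_mono (Set.image_mono fun u hu => hF u hu) hx, hxU⟩
  rw [key]
  exact MeasurableSet.biUnion (Set.to_countable _) fun F _ =>
    MeasurableSet.biInter F.countable_toSet fun u _ => hT u

theorem SB.infDim_iff (X : SB) : X.InfDim ↔ ¬ X.toSubmodule.FG := by
  rw [SB.InfDim]
  exact not_congr Module.Finite.iff_fg

theorem EquivalentSequences.map {G Z W : Type*} [NormedAddCommGroup G] [NormedSpace ℝ G]
    [NormedAddCommGroup Z] [NormedSpace ℝ Z] [NormedAddCommGroup W] [NormedSpace ℝ W]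
    {g : ℕ → G} {z : ℕ → Z} (J : Z →ₗᵢ[ℝ] W) (h : EquivalentSequences g z) :
    EquivalentSequences g fun k => J (z k) := by
  obtain ⟨c, C, hc, h⟩ := h
  refine ⟨c, C, hc, fun a => ?_⟩
  have : Finsupp.linearCombination ℝ (fun k => J (z k)) a =
      J (Finsupp.linearCombination ℝ z a) := by
    simp [Finsupp.linearCombination_apply, Finsupp.sum]
  rw [this, J.norm_map]
  exact h a

theorem EquivalentSequences.of_subtype {G Z : Type*} [NormedAddCommGroup G] [NormedSpace ℝ G]
    [NormedAddCommGroup Z] [NormedSpace ℝ Z] {M : Submodule ℝ Z} {g : ℕ → G} {z : ℕ → M}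
    (h : EquivalentSequences g fun k => (z k : Z)) : EquivalentSequences g z :=
  EquivalentSequences.of_map M.subtypeL one_pos (fun z => by simp) h

/-- The reduction: inside every infinite dimensional `X` there is an infinite dimensional `W` such
that any analytic set `B` is reduced to the spaces containing `W`, in such a way that outside `B`
all infinite dimensional spaces embedding into the image contain the unit vector basis
of `ℓ_p` (of `c_0` if `p = ∞`). -/
theorem exists_reduction {X : SB} (hX : X.InfDim) (p : ℝ≥0∞) [hp1 : Fact (1 ≤ p)] :
    ∃ W : SB, W ≤ X ∧ W.InfDim ∧ ∀ {S : Type*} [MeasurableSpace S] {B : Set S}, IsSigmaOneOne B →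
      ∃ f : S → SB, Measurable f ∧ (∀ s ∈ B, Embeds W.Space (f s).Space) ∧
        ∀ s ∉ B, ∀ Z : SB, Z.InfDim → Embeds Z.Space (f s).Space →
          ∃ z : ℕ → Z.Space, EquivalentSequences (lpUnit p) z := by
  rw [SB.infDim_iff] at hX
  obtain ⟨e, heX, he1, he⟩ := exists_basic_sequence hX
  have hli : LinearIndependent ℝ e := by
    rw [linearIndependent_iff]
    intro a ha
    ext n
    have := abs_coeff_le_of_basic he1 he a n
    rw [ha, norm_zero, mul_zero] at this
    exact abs_nonpos_iff.1 this
  set W : SB := (Submodule.span ℝ (Set.range e)).closure with hW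
  have heW : ∀ n, e n ∈ W.toSubmodule := fun n => subset_closure (Submodule.subset_span ⟨n, rfl⟩)
  refine ⟨W, ?_, ?_, ?_⟩
  · rw [hW, Submodule.closure_le, Submodule.span_le]
    rintro _ ⟨n, rfl⟩
    exact heX n
  · rw [SB.infDim_iff]
    exact Submodule.not_fg_of_linearIndependent hli heW
  intro S _ B hB
  obtain ⟨T, hTm, hTc, hTB⟩ := hB.exists_trees
  -- the tree space of the full tree, transported to `C(Δ)`
  have hmem : ∀ u, treeVec p e u ∈ treeSubspace p e Set.univ := fun u =>
    subset_closure (Submodule.subset_span ⟨u, trivial, rfl⟩)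
  have hsep : TopologicalSpace.SeparableSpace (treeSubspace p e Set.univ) :=
    ((Set.countable_univ.image (treeVec p e)).isSeparable.span (R := ℝ)).closure.separableSpace
  have hcomp : CompleteSpace (treeSubspace p e Set.univ) :=
    (Submodule.isClosed_topologicalClosure _).completeSpace_coe
  obtain ⟨J⟩ := exists_linearIsometry_cDelta (treeSubspace p e Set.univ)
  set b : List ℕ → CDelta := fun u => J ⟨treeVec p e u, hmem u⟩ with hb
  refine ⟨fun s => (Submodule.span ℝ (b '' T s)).closure, measurable_closure_span b hTm, ?_, ?_⟩
  · intro s hs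
    obtain ⟨σ, hσ⟩ := (hTB s).1 hs
    have h1 : EquivalentSequences e fun n => treeVec p e (PiNat.res σ n) :=
      equivalentSequences_branch he (fun m n h => suffix_res h) (PiNat.res_length σ)
    have h2 : EquivalentSequences e fun n => b (PiNat.res σ n) :=
      (EquivalentSequences.of_subtype (M := treeSubspace p e Set.univ)
        (z := fun n => ⟨treeVec p e (PiNat.res σ n), hmem _⟩) h1).map J
    have h3 : EquivalentSequences e fun n => (⟨b (PiNat.res σ n), subset_closure
        (Submodule.subset_span ⟨_, hσ n, rfl⟩)⟩ :
          SB.Space ((Submodule.span ℝ (b '' T s)).closure)) := EquivalentSequences.of_subtype h2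
    have h4 : EquivalentSequences (fun n => (⟨e n, heW n⟩ : W.Space)) fun n =>
        (⟨b (PiNat.res σ n), subset_closure (Submodule.subset_span ⟨_, hσ n, rfl⟩)⟩ :
          SB.Space ((Submodule.span ℝ (b '' T s)).closure)) := by
      refine h3.congr_norm fun a => ?_
      have : Finsupp.linearCombination ℝ e a = W.toSubmodule.subtype
          (Finsupp.linearCombination ℝ (fun n => (⟨e n, heW n⟩ : W.Space)) a) := by
        rw [Finsupp.apply_linearCombination]
        rfl
      rw [this]
      rfl
    have : CompleteSpace (SB.Space ((Submodule.span ℝ (b '' T s)).closure)) :=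
      (ClosedSubmodule.isClosed _).completeSpace_coe
    refine h4.embeds ?_
    rw [dense_iff_closure_eq, Set.eq_univ_iff_forall]
    rintro ⟨x, hx⟩
    rw [closure_subtype]
    refine closure_mono ?_ (show x ∈ closure (Submodule.span ℝ (Set.range e) : Set CDelta) from hx)
    rw [← Submodule.coe_subtype, ← Submodule.map_coe, Submodule.map_span, ← Set.range_comp]
    exact subset_rfl
  · intro s hs Z hZ ⟨U, c, hc, hU⟩
    have hwf : ¬ ∃ σ : ℕ → ℕ, ∀ n, PiNat.res σ n ∈ T s := fun h => hs ((hTB s).2 h)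
    set U' : Z.Space →L[ℝ] CDelta :=
      (Submodule.subtypeL ((Submodule.span ℝ (b '' T s)).closure : SB).toSubmodule).comp U with hU'
    have hU'c : ∀ z, c * ‖z‖ ≤ ‖U' z‖ := hU
    set M : Submodule ℝ (treeSubspace p e Set.univ) :=
      (treeSubspace p e (T s)).comap (Submodule.subtype _) with hM
    -- all vectors of the space coded by `T s` come from the tree space of `T s`
    have hfs : ∀ x ∈ ((Submodule.span ℝ (b '' T s)).closure : SB), ∃ m ∈ M, J m = x := by
      have hMc : IsClosed (J '' (M : Set (treeSubspace p e Set.univ))) :=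
        J.isometry.isClosedEmbedding.isClosedMap _
          ((Submodule.isClosed_topologicalClosure _).preimage continuous_subtype_val)
      intro x hx
      refine closure_minimal (t := J '' (M : Set (treeSubspace p e Set.univ))) ?_ hMc hx
      have : Submodule.span ℝ (b '' T s) ≤ M.map J.toLinearMap := by
        rw [Submodule.span_le]
        rintro _ ⟨u, hu, rfl⟩
        exact ⟨_, subset_closure (Submodule.subset_span ⟨u, hu, rfl⟩), rfl⟩
      exact this
    set R : Submodule ℝ (treeSubspace p e Set.univ) :=
      (LinearMap.range U'.toLinearMap).comap J.toLinearMap with hR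
    have hRM : R ≤ M := by
      rintro v ⟨z, hz⟩
      obtain ⟨m, hm, hmz⟩ := hfs (U z) (U z).2
      have : m = v := J.injective (hmz.trans hz)
      exact this ▸ hm
    have hRfg : ¬ R.FG := by
      intro h
      have h1 : LinearMap.range U'.toLinearMap ≤ R.map J.toLinearMap := by
        rintro _ ⟨z, rfl⟩
        obtain ⟨m, hm, hmz⟩ := hfs (U z) (U z).2
        exact ⟨m, ⟨z, hmz.symm⟩, hmz⟩
      have hfin : Module.Finite ℝ (R.map J.toLinearMap) := Module.Finite.iff_fg.2 (h.map _)
      have hfin2 : Module.Finite ℝ (LinearMap.range U'.toLinearMap) :=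
        Submodule.finiteDimensional_of_le h1
      have hinj : Function.Injective U'.toLinearMap.rangeRestrict := by
        rw [← LinearMap.ker_eq_bot, LinearMap.ker_rangeRestrict, LinearMap.ker_eq_bot']
        intro z hz
        have h2 := hU'c z
        have h3 : U' z = 0 := hz
        rw [h3, norm_zero] at h2
        exact norm_le_zero_iff.1 (nonpos_of_mul_nonpos_right h2 hc)
      exact hZ (Module.Finite.of_injective _ hinj)
    obtain ⟨y, hy, hyeq⟩ := exists_equivalentSequences_lpUnit (e := e) (p := p) (hTc s) hwf
      (Y := R.map (Submodule.subtype _))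
      (fun h => hRfg (Submodule.fg_of_fg_map_injective _ (Submodule.injective_subtype _) h))
      (by rintro _ ⟨v, hv, rfl⟩; exact hRM hv)
    choose v hv hvy using hy
    choose z hz using hv
    refine ⟨z, EquivalentSequences.of_map U' hc hU'c ?_⟩
    have h1 : EquivalentSequences (lpUnit p) v :=
      EquivalentSequences.of_subtype
        ((funext hvy : (fun k => (v k : TreeSpace CDelta p)) = y) ▸ hyeq)
    have h2 := h1.map J
    have h3 : (fun k => U' (z k)) = fun k => J (v k) := funext hz
    rw [h3]
    exact h2

theorem SB.IsPure.isAlmostPure {P : Set SB} (h : SB.IsPure P) : SB.IsAlmostPure P :=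
  ⟨h.1, fun X hX Y hY hinf => ⟨Y, le_rfl, hinf, h.2 X hX Y hY hinf⟩⟩

/-- If an infinite dimensional Banach space is isomorphic to no member of a pure class, it embeds
into no member. -/
theorem SB.IsPure.not_embeds {P : Set SB} (h : SB.IsPure P) {G : Type*} [NormedAddCommGroup G]
    [NormedSpace ℝ G] [CompleteSpace G] (hG : ¬ FiniteDimensional ℝ G)
    (hP : ∀ Y ∈ P, ¬ Isomorphic Y.Space G) : ∀ Y ∈ P, ¬ Embeds G Y.Space := by
  rintro Y hY ⟨U, c, hc, hU⟩
  set U' : G →L[ℝ] CDelta := (Submodule.subtypeL Y.toSubmodule).comp U with hU'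
  have hanti : AntilipschitzWith (Real.toNNReal c⁻¹) U' := by
    refine ContinuousLinearMap.antilipschitz_of_bound U' fun x => ?_
    rw [Real.coe_toNNReal _ (inv_nonneg.2 hc.le), ← div_eq_inv_mul, le_div_iff₀ hc, mul_comm]
    exact hU x
  have hcl : IsClosed (Set.range U') := hanti.isClosed_range U'.uniformContinuous
  let V : SB := ⟨LinearMap.range U'.toLinearMap, hcl⟩
  let φ : G ≃L[ℝ] V.Space := U'.equivRange hanti.injective hcl
  have hVinf : V.InfDim := fun hfin => hG (Module.Finite.equiv φ.symm.toLinearEquiv)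
  have hVY : V ≤ Y := by
    rintro _ ⟨x, rfl⟩
    exact (U x).2
  exact hP V (h.2 Y hY V hVY hVinf) ⟨φ.symm⟩

theorem not_finiteDimensional_of_linearIndependent {G : Type*} [NormedAddCommGroup G]
    [NormedSpace ℝ G] {g : ℕ → G} (hg : LinearIndependent ℝ g) : ¬ FiniteDimensional ℝ G := by
  intro h
  have := hg.finite_of_isNoetherian
  exact not_finite ℕ

theorem not_finiteDimensional_ellP (p : ℝ≥0∞) [Fact (1 ≤ p)] : ¬ FiniteDimensional ℝ (EllP p) := by
  refine not_finiteDimensional_of_linearIndependent (g := lpUnit p) ?_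
  rw [linearIndependent_iff]
  intro a ha
  ext n
  rw [← lpUnit_linearCombination_apply (p := p), ha]
  rfl

theorem not_finiteDimensional_cZero : ¬ FiniteDimensional ℝ CZero := by
  refine not_finiteDimensional_of_linearIndependent (g := czeroUnit) ?_
  rw [linearIndependent_iff]
  intro a ha
  ext n
  rw [← czeroUnit_linearCombination_apply, ha]
  rfl

/-- The common part of the cases of `ℓ_p` and of `c_0`. -/
theorem SB.IsAlmostPure.isSigmaOneOneHard {P : Set SB} (hne : P.Nonempty)
    (hinf : ∀ X ∈ P, X.InfDim) (hP : SB.IsAlmostPure P) (p : ℝ≥0∞) [Fact (1 ≤ p)]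
    (h : ∀ Y ∈ P, ¬ ∃ y : ℕ → Y.Space, EquivalentSequences (lpUnit p) y) :
    IsSigmaOneOneHard.{0, v} (SB.containing P) := by
  intro S _ _ B hB
  obtain ⟨X, hX⟩ := hne
  obtain ⟨W, hWX, hW, hred⟩ := exists_reduction (hinf X hX) p
  obtain ⟨f, hf, hfB, hfB'⟩ := hred hB
  refine ⟨f, hf, Set.ext fun s => ⟨?_, fun hs => ?_⟩⟩
  · rintro ⟨Z, hZP, hZ⟩
    by_contra hs
    exact h Z hZP (hfB' s hs Z (hinf Z hZP) hZ)
  · obtain ⟨Z, hZW, -, hZP⟩ := hP.2 X hX W hWX hW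
    obtain ⟨U, c, hc, hU⟩ := hfB s hs
    let i : Z.Space →L[ℝ] W.Space :=
      Z.toSubmodule.subtypeL.codRestrict W.toSubmodule fun z => hZW z.2
    exact ⟨Z, hZP, U.comp i, c, hc, fun z => hU (i z)⟩

theorem SB.completeSpace (Y : SB) : CompleteSpace Y.Space := Y.isClosed.completeSpace_coe

end Reduction

theorem theorem4p3 (P : Set SB) (hne : P.Nonempty) (hinf : ∀ X ∈ P, X.InfDim) :
    (SB.IsAlmostPure P →
      (∀ (p : ℝ≥0∞) [Fact (1 ≤ p)], p ≠ ⊤ → (∀ Y ∈ P, ¬ Embeds (EllP p) Y.Space) →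
        IsSigmaOneOneHard.{0, v} (SB.containing P)) ∧
      ((∀ Y ∈ P, ¬ Embeds CZero Y.Space) → IsSigmaOneOneHard.{0, v} (SB.containing P))) ∧
    (SB.IsPure P →
      (∀ (p : ℝ≥0∞) [Fact (1 ≤ p)], p ≠ ⊤ → (∀ Y ∈ P, ¬ Isomorphic Y.Space (EllP p)) →
        IsSigmaOneOneHard.{0, v} (SB.containing P)) ∧
      ((∀ Y ∈ P, ¬ Isomorphic Y.Space CZero) → IsSigmaOneOneHard.{0, v} (SB.containing P))) := by
  have hlp : SB.IsAlmostPure P → ∀ (p : ℝ≥0∞) [Fact (1 ≤ p)], p ≠ ⊤ →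
      (∀ Y ∈ P, ¬ Embeds (EllP p) Y.Space) → IsSigmaOneOneHard.{0, v} (SB.containing P) :=
    fun hP p _ hp h => hP.isSigmaOneOneHard hne hinf p fun Y hY ⟨y, hy⟩ =>
      have := Y.completeSpace
      h Y hY (hy.embeds (dense_span_lpUnit hp))
  have hc0 : SB.IsAlmostPure P →
      (∀ Y ∈ P, ¬ Embeds CZero Y.Space) → IsSigmaOneOneHard.{0, v} (SB.containing P) :=
    fun hP h => hP.isSigmaOneOneHard hne hinf ⊤ fun Y hY ⟨y, hy⟩ =>
      have := Y.completeSpace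
      h Y hY ((hy.congr_norm norm_linearCombination_lpUnit_top).embeds dense_span_czeroUnit)
  exact ⟨fun hP => ⟨hlp hP, hc0 hP⟩, fun hP =>
    ⟨fun p _ hp h => hlp hP.isAlmostPure p hp (hP.not_embeds (not_finiteDimensional_ellP p) h),
      fun h => hc0 hP.isAlmostPure (hP.not_embeds not_finiteDimensional_cZero h)⟩⟩
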